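/- Let $(R,\mathfrak m)$ be a regular local domain with $\dim R\ge 2$ and fraction field $K$, and let $I$ be an $\mathfrak m$-primary ideal of $R$. Notation. The normalized blowup $\operatorname{Proj}\overline{R[It]}$ is regarded as the set of all local subrings $B_P$ of $K$, where $B$ is the integral closure in $K$ of $R[I/a]$ for some $0\ne a\in I$, and $P$ is a prime ideal of $B$. Without taking integral closures one obtains the blowup $\operatorname{Proj}R[It]$. A local ring $T$ with $R\subseteq T\subseteq K$ dominates $R$ if its maximal ideal contracts to $\mathfrak m$. The points of the first neighborhood of $R$ are the local rings $T$ on $\operatorname{Proj}R[\mathfrak m t]$ that dominate $R$ and have $\dim T\ge 2$. Such a $T$ is a base point of $I$ if the transform $I^T=a^{-1}IT$ is a proper ideal of $T$, where $aT$ is the smallest principal ideal of $T$ containing $IT$. Let $\operatorname{ord}_R$ denote the valuation ring $\{f/g : f,g\in R,\ g\neq 0,\ \operatorname{ord}(g)\le \operatorname{ord}(f)\}$, where $\operatorname{ord}(f)=\sup\{n : f\in\mathfrak m^n\}$. Let $\operatorname{Rees} I$ denote the set of Rees valuation rings of $I$, that is, the discrete valuation rings $V$ on $\operatorname{Proj}\overline{R[It]}$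 with $IV\ne V$. Assume that $I$ has only finitely many base points in the first neighborhood of $R$. Let $S$ be a local ring on $\operatorname{Proj}\overline{R[It]}$ that dominates $R$. If either 1. $S$ is a unique factorization domain, or 2. $S$ has torsion divisor class group (for every divisorial fractional ideal $J$ of $S$ there is $n>0$ such that the divisorial hull $((J^n)^{-1})^{-1}$ is principal), and either $\operatorname{ord}_R\in\operatorname{Rees} I$ or $S\not\subseteq\operatorname{ord}_R$, then $\mathfrak m S$ is a principal ideal of $S$. -/

import Mathlib

noncomputable section

namespace BirationalModel

open IsLocalRing

section Models

variable {R K : Type*} [CommRing R] [Field K] [Algebra R K]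

/-- The localization `B_P = {b / c | b, c ∈ B, c ∉ P}`, formed inside the field `K`, of a subring
`B` of `K` containing (the image of) `R`, at a prime ideal `P` of `B`. -/
def localizationAt (B : Subalgebra R K) (P : Ideal B) [hP : P.IsPrime] : Subalgebra R K where
  carrier := {x | ∃ b c : B, c ∉ P ∧ x = (b : K) / (c : K)}
  mul_mem' := by
    rintro _ _ ⟨b, c, hc, rfl⟩ ⟨b', c', hc', rfl⟩
    refine ⟨b * b', c * c', fun h => (hP.mem_or_mem h).elim hc hc', ?_⟩
    push_cast
    rw [div_mul_div_comm]
  add_mem' := by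
    rintro _ _ ⟨b, c, hc, rfl⟩ ⟨b', c', hc', rfl⟩
    refine ⟨b * c' + c * b', c * c', fun h => (hP.mem_or_mem h).elim hc hc', ?_⟩
    have h : (c : K) ≠ 0 := fun h0 => hc (by
      have h1 : c = 0 := Subtype.ext h0
      exact h1 ▸ P.zero_mem)
    have h' : (c' : K) ≠ 0 := fun h0 => hc' (by
      have h1 : c' = 0 := Subtype.ext h0
      exact h1 ▸ P.zero_mem)
    push_cast
    rw [div_add_div _ _ h h']
  algebraMap_mem' := fun r =>
    ⟨algebraMap R B r, 1, fun h => hP.ne_top ((Ideal.eq_top_iff_one P).2 h), by simp⟩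

/-- The affine model of `B` : the set of all local rings `B_P`, with `P` a prime ideal of `B`. -/
def affineModel (B : Subalgebra R K) : Set (Subalgebra R K) :=
  {S | ∃ (P : Ideal B) (_ : P.IsPrime), S = localizationAt B P}

/-- The affine chart `R[I/a]`, generated over `R` by the fractions `b / a` with `b ∈ I`. -/
def blowupChart (K : Type*) [Field K] [Algebra R K] (I : Ideal R) (a : R) : Subalgebra R K :=
  Algebra.adjoin R {x : K | ∃ b ∈ I, x = algebraMap R K b / algebraMap R K a}

/-- The integral closure of the chart `R[I/a]` in `K`. -/
def normalizedBlowupChart (K : Type*) [Field K] [Algebra R K] (I : Ideal R) (a : R) :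
    Subalgebra R K :=
  (integralClosure (blowupChart K I a) K).restrictScalars R

/-- The blowup `Proj R[It]`, as a set of local rings with fraction field `K`: the union of the
affine models of the charts `R[I/a]`, `0 ≠ a ∈ I`. -/
def blowup (K : Type*) [Field K] [Algebra R K] (I : Ideal R) : Set (Subalgebra R K) :=
  {S | ∃ a ∈ I, a ≠ 0 ∧ S ∈ affineModel (blowupChart K I a)}

/-- The normalized blowup, that is, `Proj` of the integral closure of the Rees algebra `R[It]`,
as a set of local rings with fraction field `K`. The elements `a t`, `0 ≠ a ∈ I`, generate the
irrelevant ideal up to radical, and the degree zero part of the localization of the integral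
closure of `R[It]` at `a t` is the integral closure of `R[I/a]`. -/
def normalizedBlowup (K : Type*) [Field K] [Algebra R K] (I : Ideal R) : Set (Subalgebra R K) :=
  {S | ∃ a ∈ I, a ≠ 0 ∧ S ∈ affineModel (normalizedBlowupChart K I a)}

/-- `S` dominates the local ring `R`: elements of the maximal ideal of `R` are
nonunits of `S`. -/
def Dominates (S : Subalgebra R K) : Prop := IsLocalHom (algebraMap R S)

/-- The Rees valuation rings of `I`: the discrete valuation rings `V` on the normalized blowup
of `I` whose center on `R` contains `I` (the local rings of the prime divisors over `I`). -/
def reesValuationRings (K : Type*) [Field K] [Algebra R K] (I : Ideal R) :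
    Set (Subalgebra R K) :=
  {V | V ∈ normalizedBlowup K I ∧ IsDiscreteValuationRing V ∧ I.map (algebraMap R V) ≠ ⊤}

/-- `J` is the transform `a⁻¹IT` of `I` in `T`, where `aT` is the smallest principal ideal of `T`
containing `IT`. -/
def IsTransform (I : Ideal R) (T : Subalgebra R K) (J : Ideal T) : Prop :=
  ∃ a : T, a ≠ 0 ∧
    IsLeast {L : Ideal T | Submodule.IsPrincipal L ∧ I.map (algebraMap R T) ≤ L}
      (Ideal.span {a}) ∧
    Ideal.span {a} * J = I.map (algebraMap R T)

section Local

variable [IsLocalRing R]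

/-- The points infinitely near to the regular local ring `R` in its first neighborhood: the local
quadratic transforms of `R` (local rings on the blowup of the maximal ideal that dominate `R`)
of dimension at least two. They are automatically regular local rings. -/
def firstNeighborhood (R K : Type*) [CommRing R] [Field K] [Algebra R K] [IsLocalRing R] :
    Set (Subalgebra R K) :=
  {T | T ∈ blowup K (maximalIdeal R) ∧ Dominates T ∧ 2 ≤ ringKrullDim T}

/-- The base points of `I` in the first neighborhood of `R`: the points `T` of the first
neighborhood for which the transform of `I` in `T` is a proper ideal. -/
def basePointsInFirstNeighborhood (K : Type*) [Field K] [Algebra R K] (I : Ideal R) :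
    Set (Subalgebra R K) :=
  {T | T ∈ firstNeighborhood R K ∧ ∃ J : Ideal T, IsTransform I T J ∧ J ≠ ⊤}

/-- The order function of a local ring: `ord f = sup {n | f ∈ 𝔪ⁿ}`. -/
def ord (f : R) : ℕ∞ := ⨆ (n : ℕ) (_ : f ∈ maximalIdeal R ^ n), (n : ℕ∞)

/-- The valuation ring of the order valuation of a regular local ring `R` with fraction field `K`,
as a subset of `K`: the fractions `f / g` with `g ≠ 0` and `ord g ≤ ord f`. -/
def ordValuationRing (R K : Type*) [CommRing R] [Field K] [Algebra R K] [IsLocalRing R] : Set K :=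
  {x | ∃ f g : R, g ≠ 0 ∧ ord g ≤ ord f ∧ x = algebraMap R K f / algebraMap R K g}

end Local

end Models

open scoped nonZeroDivisors in
/-- The divisor class group of the normal domain `A` is a torsion group: every divisorial
fractional ideal `J` (nonzero with `(J⁻¹)⁻¹ = J`) has a power `Jⁿ`, `n > 0`, whose
divisorial hull `((Jⁿ)⁻¹)⁻¹`, which represents the `n`-th multiple of the class of `J`, is
principal. -/
def HasTorsionDivisorClassGroup (A : Type*) [CommRing A] [IsDomain A] : Prop :=
  ∀ J : FractionalIdeal A⁰ (FractionRing A), J ≠ 0 → (J⁻¹)⁻¹ = J →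
    ∃ n : ℕ, 0 < n ∧ ∃ x : FractionRing A, x ≠ 0 ∧
      ((J ^ n)⁻¹)⁻¹ = FractionalIdeal.spanSingleton A⁰ x

end BirationalModel

end

/-!
Let `r` be the order of `I` and `IS = aS`. For a valuation ring `W` dominating `S`, let `x` generate
`𝔪W`. Then `a ∈ xʳW`, and there are two cases.

If `aW ≠ xʳW` for all `W`, then `I` extends to a proper ideal of `W` after division by `xʳ`, so that
the center of `W` on the blowup of `𝔪` is a base point of `I`. By homogeneous prime avoidance one
form `F ∈ 𝔪ᵉ` generates the extension of `𝔪ᵉ` to all of the finitely many base points. Since `S` is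
the intersection of the valuation rings dominating it, `F` generates `𝔪ᵉS`, so `𝔪S` is invertible.

If `aW = xʳW` for some `W`, then `S` is contained in the local quadratic transform `T` of `R` along
`W`. The divisorial hull of `𝔪ⁿS` is `gS` for some `n > 0` and some `g`. In `T`, an element whose
order is at least `n` is divisible by `xⁿ`; this gives `gW = xⁿW`, so that `gʳ` and `aⁿ` have the
same value. Since `aⁿ ∈ 𝔪ⁿʳS ⊆ gʳS`, it follows that `𝔪ⁿʳS = aⁿS`, and `𝔪S` is invertible.
-/

noncomputable section

namespace BirationalModel

open IsLocalRing

/-! ### Independence of a regular system of parameters -/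

section RegularSystemOfParameters

open MvPolynomial

section HomogeneousEval

variable {A ι : Type*} [CommRing A] {n : ℕ} {H : MvPolynomial ι A}

theorem eval_mul_left_of_isHomogeneous (hH : H.IsHomogeneous n) (t : A) (u : ι → A) :
    eval (fun i => t * u i) H = t ^ n * eval u H := by
  rw [eval_eq, eval_eq, Finset.mul_sum]
  refine Finset.sum_congr rfl fun d hd => ?_
  have hdeg : ∑ i ∈ d.support, d i = n := hH.degree_eq_sum_deg_support hd ▸ rfl
  simp only [mul_pow, Finset.prod_mul_distrib, Finset.prod_pow_eq_pow_sum, hdeg]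
  ring

theorem map_eval_eq_eval_map {B : Type*} [CommRing B] (f : A →+* B) (u : ι → A)
    (P : MvPolynomial ι A) : f (eval u P) = eval (f ∘ u) (map f P) := by
  rw [eval_map, eval, coe_eval₂Hom, hom_eval₂, RingHom.comp_id]; rfl

theorem eval_sub_pow_mul_eval_mem (hH : H.IsHomogeneous n) {N : Ideal A} {x u : ι → A} {t : A}
    (hx : ∀ i, x i - u i * t ∈ N) : eval x H - t ^ n * eval u H ∈ N := by
  have hcongr : Ideal.Quotient.mk N ∘ x = Ideal.Quotient.mk N ∘ fun i => t * u i :=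
    _root_.funext fun i => Ideal.Quotient.eq.2 (by simpa only [mul_comm t] using hx i)
  rw [← eval_mul_left_of_isHomogeneous hH, ← Ideal.Quotient.eq, map_eval_eq_eval_map,
    map_eval_eq_eval_map, hcongr]

end HomogeneousEval

section Independence

variable {A ι : Type*} [CommRing A] [IsLocalRing A] {x : ι → A} {n : ℕ} {H : MvPolynomial ι A}

/-- A regular system of parameters of a local ring: a family that generates the maximal ideal and
has no more members than the height of the maximal ideal. -/
structure IsRegularSystemOfParameters (x : ι → A) : Prop where
  span_range_eq : Ideal.span (Set.range x) = maximalIdeal A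
  card_le_height : (Nat.card ι : ℕ∞) ≤ (maximalIdeal A).height

theorem maximalIdeal_height_lt_card_of_pow_mem_span [IsNoetherianRing A] [Finite ι]
    (hx : Ideal.span (Set.range x) = maximalIdeal A) {j : ι} {u : ι → A}
    (h : x j ^ n ∈ Ideal.span ((fun i => x i - u i * x j) '' {j}ᶜ)) :
    (maximalIdeal A).height < Nat.card ι := by
  set N := Ideal.span ((fun i => x i - u i * x j) '' {j}ᶜ) with hN
  have hxm (i : ι) : x i ∈ maximalIdeal A := hx ▸ Ideal.subset_span (Set.mem_range_self i)
  have hNm : N ≤ maximalIdeal A := by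
    rw [hN, Ideal.span_le]
    rintro _ ⟨i, -, rfl⟩
    exact sub_mem (hxm i) (Ideal.mul_mem_left _ _ (hxm j))
  have hmin : maximalIdeal A ∈ N.minimalPrimes := by
    refine ⟨⟨inferInstance, hNm⟩, fun q ⟨hq, hNq⟩ _ => ?_⟩
    have hxj : x j ∈ q := hq.mem_of_pow_mem n (hNq h)
    rw [← hx, Ideal.span_le]
    rintro _ ⟨i, rfl⟩
    obtain rfl | hij := eq_or_ne i j
    · exact hxj
    · simpa using add_mem (hNq (Ideal.subset_span ⟨i, hij, rfl⟩)) (Ideal.mul_mem_left q (u i) hxj)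
  calc (maximalIdeal A).height ≤ ((fun i => x i - u i * x j) '' {j}ᶜ).ncard :=
        mod_cast Ideal.height_le_card_of_mem_minimalPrimes_span (Set.toFinite _) hmin
    _ ≤ ({j}ᶜ : Set ι).ncard := mod_cast Set.ncard_image_le
    _ < (Set.univ : Set ι).ncard := mod_cast Set.ncard_lt_ncard
        (Set.ssubset_univ_iff.2 fun h => (h ▸ Set.mem_univ j : j ∈ ({j}ᶜ : Set ι)) rfl)
    _ = Nat.card ι := by rw [Set.ncard_univ]

theorem eval_notMem_maximalIdeal_pow [IsNoetherianRing A] [Finite ι]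
    (hx : IsRegularSystemOfParameters x) (hH : H.IsHomogeneous n) {j : ι} {u : ι → A}
    (hj : u j = 1) (hu : IsUnit (eval u H)) :
    eval x H ∉ maximalIdeal A ^ (n + 1) := by
  intro hmem
  rw [← hx.span_range_eq, Ideal.mem_span_pow_iff_exists_isHomogeneous] at hmem
  obtain ⟨Q, hQ, hQH⟩ := hmem
  refine hx.card_le_height.not_gt (maximalIdeal_height_lt_card_of_pow_mem_span hx.span_range_eq
    (n := n) (j := j) (u := u) ?_)
  set N := Ideal.span ((fun i => x i - u i * x j) '' {j}ᶜ)
  have hxN (i : ι) : x i - u i * x j ∈ N := by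
    obtain rfl | hij := eq_or_ne i j
    · simp [hj]
    · exact Ideal.subset_span ⟨i, hij, rfl⟩
  have hunit : IsUnit (eval u H - x j * eval u Q) := by
    by_contra hn
    have hxj : x j ∈ maximalIdeal A :=
      hx.span_range_eq ▸ Ideal.subset_span (Set.mem_range_self j)
    have hum : eval u H ∈ maximalIdeal A :=
      (Submodule.sub_mem_iff_left _ (Ideal.mul_mem_right _ _ hxj)).1 hn
    exact hum hu
  refine (Ideal.mul_unit_mem_iff_mem N hunit).1 ?_
  have := sub_mem (eval_sub_pow_mul_eval_mem hQ hxN) (eval_sub_pow_mul_eval_mem hH hxN)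
  rw [hQH] at this
  convert this using 1
  ring

theorem exists_eq_one_and_isUnit_eval [Infinite (ResidueField A)] (hH : H.IsHomogeneous n)
    (h0 : map (residue A) H ≠ 0) (j : ι) : ∃ u : ι → A, u j = 1 ∧ IsUnit (eval u H) := by
  obtain ⟨c', hc'⟩ : ∃ c', eval c' (X j * map (residue A) H) ≠ 0 := by
    by_contra! hall
    exact mul_ne_zero (X_ne_zero j) h0 (MvPolynomial.funext fun c => by simpa using hall c)
  obtain ⟨c, rfl⟩ := residue_surjective.comp_left c'
  rw [map_mul, eval_X, ← map_eval_eq_eval_map, mul_ne_zero_iff] at hc'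
  simp only [Function.comp_apply, residue_ne_zero_iff_isUnit] at hc'
  obtain ⟨w, hw⟩ := hc'.1.exists_left_inv
  refine ⟨fun i => w * c i, hw, ?_⟩
  rw [eval_mul_left_of_isHomogeneous hH]
  exact ((IsUnit.of_mul_eq_one _ hw).pow n).mul hc'.2

theorem map_residue_eq_zero_of_eval_mem_of_infinite [IsNoetherianRing A]
    [Infinite (ResidueField A)] [Finite ι] (hx : IsRegularSystemOfParameters x)
    (hH : H.IsHomogeneous n) (h : eval x H ∈ maximalIdeal A ^ (n + 1)) : map (residue A) H = 0 := by
  obtain _ | ⟨⟨j⟩⟩ := isEmpty_or_nonempty ι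
  · obtain ⟨a, rfl⟩ := C_surjective ι H
    rw [eval_C] at h
    rw [map_C, (residue_eq_zero_iff a).2 (Ideal.pow_le_self n.succ_ne_zero h), C_0]
  · by_contra h0
    obtain ⟨u, hj, hu⟩ := exists_eq_one_and_isUnit_eval hH h0 j
    exact eval_notMem_maximalIdeal_pow hx hH hj hu h

end Independence

section PolynomialExtension

variable (A : Type*) [CommRing A] [IsLocalRing A]

open Polynomial in
/-- The ideal `𝔪A[X]`. The local ring of `A[X]` at this prime, usually written `A(X)`, has an
infinite residue field, the same height, and the maximal ideal generated by `𝔪`. -/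
abbrev polynomialMaximalIdeal : Ideal A[X] := (maximalIdeal A).map Polynomial.C

instance : (polynomialMaximalIdeal A).IsPrime := Ideal.isPrime_map_C_of_isPrime

/-- The local ring `A(X)`, the localization of `A[X]` at `𝔪A[X]`, which replaces `A` by a local
ring with infinite residue field. -/
abbrev PolynomialLocalization : Type _ := Localization.AtPrime (polynomialMaximalIdeal A)

theorem maximalIdeal_polynomialLocalization :
    maximalIdeal (PolynomialLocalization A)
      = (maximalIdeal A).map (algebraMap A (PolynomialLocalization A)) := by
  rw [← Localization.AtPrime.map_eq_maximalIdeal, Ideal.map_map]; rfl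

instance : IsLocalHom (algebraMap A (PolynomialLocalization A)) :=
  ((local_hom_TFAE (algebraMap A (PolynomialLocalization A))).out 0 2 :).2
    (maximalIdeal_polynomialLocalization A).ge

instance : Infinite (ResidueField (PolynomialLocalization A)) := by
  let f := algebraMap (Polynomial A) (PolynomialLocalization A)
  refine Infinite.of_injective (fun n : ℕ => residue _ (f (Polynomial.X ^ n))) fun a b hab => ?_
  by_contra hne
  have hmem : (Polynomial.X ^ a - Polynomial.X ^ b : Polynomial A) ∈ polynomialMaximalIdeal A := by
    rw [← IsLocalization.AtPrime.to_map_mem_maximal_iff (PolynomialLocalization A)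
      (polynomialMaximalIdeal A), map_sub, ← residue_eq_zero_iff, map_sub, sub_eq_zero]
    exact hab
  have hcoeff := Ideal.mem_map_C_iff.1 hmem a
  rw [Polynomial.coeff_sub, Polynomial.coeff_X_pow_self, Polynomial.coeff_X_pow, if_neg hne,
    sub_zero] at hcoeff
  exact (Ideal.ne_top_iff_one _).1 (maximalIdeal.isMaximal A).ne_top hcoeff

theorem height_maximalIdeal_polynomialLocalization [IsNoetherianRing A] :
    (maximalIdeal (PolynomialLocalization A)).height = (maximalIdeal A).height := by
  rw [← Polynomial.height_map_C (maximalIdeal A),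
    ← IsLocalization.height_under (polynomialMaximalIdeal A).primeCompl,
    Localization.AtPrime.under_maximalIdeal]

end PolynomialExtension

theorem map_residue_eq_zero_of_eval_mem {A ι : Type*} [CommRing A] [IsNoetherianRing A]
    [IsLocalRing A] [Finite ι] {x : ι → A} (hx : IsRegularSystemOfParameters x) {n : ℕ}
    {H : MvPolynomial ι A} (hH : H.IsHomogeneous n) (h : eval x H ∈ maximalIdeal A ^ (n + 1)) :
    map (residue A) H = 0 := by
  let f := algebraMap A (PolynomialLocalization A)
  have hfx : IsRegularSystemOfParameters (f ∘ x) :=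
    ⟨by rw [maximalIdeal_polynomialLocalization, ← hx.span_range_eq, Ideal.map_span,
      ← Set.range_comp], by
      rw [height_maximalIdeal_polynomialLocalization]; exact hx.card_le_height⟩
  have heval : eval (f ∘ x) (map f H) ∈ maximalIdeal (PolynomialLocalization A) ^ (n + 1) := by
    rw [← map_eval_eq_eval_map, maximalIdeal_polynomialLocalization, ← Ideal.map_pow]
    exact Ideal.mem_map_of_mem f h
  have hzero := map_residue_eq_zero_of_eval_mem_of_infinite hfx (hH.map f) heval
  have hloc : IsLocalHom f := inferInstance
  ext d
  have hcoeff := congrArg (coeff d) hzero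
  rw [coeff_map, coeff_map, coeff_zero, residue_eq_zero_iff, mem_maximalIdeal, map_mem_nonunits_iff,
    ← mem_maximalIdeal] at hcoeff
  rwa [coeff_map, coeff_zero, residue_eq_zero_iff]

end RegularSystemOfParameters

/-! ### Leading forms and the order function -/

section LeadingForms

open MvPolynomial

section LeadingForm

variable {A ι : Type*} [CommRing A] [IsLocalRing A]

/-- `F` is the class of `f ∈ 𝔪ⁿ` modulo `𝔪ⁿ⁺¹`, written as a form of degree `n` in the classes of
the elements `x i`. It is allowed to be zero, so `n` need not be the order of `f`. -/
def IsLeadingForm (x : ι → A) (n : ℕ) (f : A) (F : MvPolynomial ι (ResidueField A)) : Prop :=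
  ∃ P : MvPolynomial ι A, P.IsHomogeneous n ∧ map (residue A) P = F ∧
    f - eval x P ∈ maximalIdeal A ^ (n + 1)

variable {x : ι → A} (hx : Ideal.span (Set.range x) = maximalIdeal A)

include hx in
theorem eval_mem_maximalIdeal_pow {n : ℕ} {P : MvPolynomial ι A} (hP : P.IsHomogeneous n) :
    eval x P ∈ maximalIdeal A ^ n := by
  rw [← hx, Ideal.mem_span_pow_iff_exists_isHomogeneous]
  exact ⟨P, hP, rfl⟩

namespace IsLeadingForm

variable {m n : ℕ} {f g : A} {F G : MvPolynomial ι (ResidueField A)}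

theorem isHomogeneous (h : IsLeadingForm x n f F) : F.IsHomogeneous n := by
  obtain ⟨P, hP, rfl, -⟩ := h
  exact hP.map _

theorem exists_of_isHomogeneous (x : ι → A) (hF : F.IsHomogeneous n) :
    ∃ f, IsLeadingForm x n f F := by
  obtain ⟨P, rfl⟩ := map_surjective (residue A) residue_surjective F
  refine ⟨_, homogeneousComponent n P, homogeneousComponent_isHomogeneous n P, ?_,
    by rw [sub_self]; exact zero_mem _⟩
  conv_rhs => rw [← homogeneousComponent_eq_self hF]
  ext d
  simp only [coeff_map, coeff_homogeneousComponent]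
  split_ifs <;> simp

theorem sub (hf : IsLeadingForm x n f F) (hg : IsLeadingForm x n g G) :
    IsLeadingForm x n (f - g) (F - G) := by
  obtain ⟨P, hP, rfl, hf⟩ := hf
  obtain ⟨Q, hQ, rfl, hg⟩ := hg
  refine ⟨P - Q, hP.sub hQ, by simp, ?_⟩
  rw [map_sub, sub_sub_sub_comm]
  exact sub_mem hf hg

include hx

theorem exists_of_mem (hf : f ∈ maximalIdeal A ^ n) : ∃ F, IsLeadingForm x n f F := by
  rw [← hx, Ideal.mem_span_pow_iff_exists_isHomogeneous] at hf
  obtain ⟨P, hP, rfl⟩ := hf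
  exact ⟨_, P, hP, rfl, by simp⟩

theorem mem (h : IsLeadingForm x n f F) : f ∈ maximalIdeal A ^ n := by
  obtain ⟨P, hP, -, h⟩ := h
  simpa using add_mem (Ideal.pow_le_pow_right n.le_succ h) (eval_mem_maximalIdeal_pow hx hP)

theorem mem_succ_of_zero (h : IsLeadingForm x n f 0) : f ∈ maximalIdeal A ^ (n + 1) := by
  obtain ⟨P, hP, h0, h⟩ := h
  suffices eval x P ∈ maximalIdeal A ^ (n + 1) by simpa using add_mem h this
  rw [as_sum P, map_sum]
  refine sum_mem fun d hd => ?_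
  rw [← mul_one (coeff d P), ← C_mul_monomial, map_mul, eval_C, pow_succ']
  refine Ideal.mul_mem_mul ?_ (eval_mem_maximalIdeal_pow hx (isHomogeneous_monomial _ ?_))
  · rw [← residue_eq_zero_iff, ← coeff_map, h0, coeff_zero]
  · exact (hP.degree_eq_sum_deg_support hd).symm

theorem mul (hf : IsLeadingForm x m f F) (hg : IsLeadingForm x n g G) :
    IsLeadingForm x (m + n) (f * g) (F * G) := by
  have hgn := hg.mem hx
  obtain ⟨P, hP, rfl, hf⟩ := hf
  obtain ⟨Q, hQ, rfl, hg⟩ := hg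
  have hfg := Ideal.mul_mem_mul hf hgn
  have hPg := Ideal.mul_mem_mul (eval_mem_maximalIdeal_pow hx hP) hg
  rw [← pow_add, add_right_comm] at hfg
  rw [← pow_add] at hPg
  refine ⟨P * Q, hP.mul hQ, by simp, ?_⟩
  convert add_mem hfg hPg using 1
  rw [map_mul]
  ring

theorem pow (hf : IsLeadingForm x n f F) (k : ℕ) : IsLeadingForm x (n * k) (f ^ k) (F ^ k) := by
  induction k with
  | zero => exact ⟨1, by simpa using isHomogeneous_one ι A, by simp, by simp⟩
  | succ k ih => simpa only [pow_succ, mul_add, mul_one] using ih.mul hx hf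

end IsLeadingForm

end LeadingForm

section Order

variable {A : Type*} [CommRing A] [IsLocalRing A] {f : A}

theorem natCast_le_ord_iff {n : ℕ} : n ≤ ord f ↔ f ∈ maximalIdeal A ^ n := by
  refine ⟨fun h => ?_, fun h =>
    le_iSup₂_of_le (f := fun (k : ℕ) (_ : f ∈ maximalIdeal A ^ k) => (k : ℕ∞)) n h le_rfl⟩
  by_contra hf
  obtain _ | n := n
  · simp at hf
  have hle : ord f ≤ n := iSup₂_le fun k hk => by
    by_contra! hlt
    exact hf (Ideal.pow_le_pow_right (by exact_mod_cast hlt) hk)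
  exact absurd (h.trans hle) (by exact_mod_cast n.lt_succ_self.not_ge)

theorem ord_eq_natCast_iff {n : ℕ} :
    ord f = n ↔ f ∈ maximalIdeal A ^ n ∧ f ∉ maximalIdeal A ^ (n + 1) := by
  rw [← natCast_le_ord_iff, ← natCast_le_ord_iff, not_le, Nat.cast_succ,
    ENat.lt_add_one_iff (ENat.natCast_ne_top n), and_comm, le_antisymm_iff]

@[simp]
theorem ord_zero : ord (0 : A) = ⊤ :=
  ENat.eq_top_iff_forall_ge.2 fun _ => natCast_le_ord_iff.2 (zero_mem _)

@[simp]
theorem ord_one : ord (1 : A) = 0 := by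
  rw [← Nat.cast_zero, ord_eq_natCast_iff]
  simp

theorem min_ord_le_ord_add (f g : A) : min (ord f) (ord g) ≤ ord (f + g) :=
  ENat.forall_natCast_le_iff_le.1 fun _ h => natCast_le_ord_iff.2 <|
    add_mem (natCast_le_ord_iff.1 (h.trans (min_le_left _ _)))
      (natCast_le_ord_iff.1 (h.trans (min_le_right _ _)))

@[simp]
theorem ord_eq_top_iff [IsNoetherianRing A] : ord f = ⊤ ↔ f = 0 := by
  rw [ENat.eq_top_iff_forall_ge]
  simp only [natCast_le_ord_iff]
  rw [← Ideal.mem_iInf, Ideal.iInf_pow_eq_bot_of_isLocalRing _ (maximalIdeal.isMaximal A).ne_top,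
    Ideal.mem_bot]

variable {ι : Type*} {x : ι → A}

theorem IsLeadingForm.exists_ne_zero [IsNoetherianRing A]
    (hx : Ideal.span (Set.range x) = maximalIdeal A) (hf : f ≠ 0) :
    ∃ (n : ℕ) (F : _), IsLeadingForm x n f F ∧ F ≠ 0 := by
  obtain ⟨n, hn⟩ := ENat.ne_top_iff_exists.1 (ord_eq_top_iff.not.2 hf)
  obtain ⟨hmem, hnotMem⟩ := ord_eq_natCast_iff.1 hn.symm
  obtain ⟨F, hF⟩ := exists_of_mem hx hmem
  exact ⟨n, F, hF, by rintro rfl; exact hnotMem (hF.mem_succ_of_zero hx)⟩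

end Order

section RegularSystem

variable {A ι : Type*} [CommRing A] [IsLocalRing A] [IsNoetherianRing A] [Finite ι] {x : ι → A}
  {m n : ℕ} {f g : A} {F G : MvPolynomial ι (ResidueField A)}

namespace IsLeadingForm

theorem eq_zero (hx : IsRegularSystemOfParameters x) (h : IsLeadingForm x n f F)
    (hf : f ∈ maximalIdeal A ^ (n + 1)) : F = 0 := by
  obtain ⟨P, hP, rfl, h⟩ := h
  exact map_residue_eq_zero_of_eval_mem hx hP (by simpa using sub_mem hf h)

theorem unique (hx : IsRegularSystemOfParameters x) (hF : IsLeadingForm x n f F)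
    (hG : IsLeadingForm x n f G) : F = G :=
  sub_eq_zero.1 ((hF.sub hG).eq_zero hx (by simp))

theorem ord_eq (hx : IsRegularSystemOfParameters x) (h : IsLeadingForm x n f F) (hF : F ≠ 0) :
    ord f = n :=
  ord_eq_natCast_iff.2 ⟨h.mem hx.span_range_eq, fun hf => hF (h.eq_zero hx hf)⟩

theorem dvd_of_dvd (hx : IsRegularSystemOfParameters x) (hf : IsLeadingForm x m f F)
    (hg : IsLeadingForm x n g G) (hG : G ≠ 0) (hgf : g ∣ f) : G ∣ F := by
  obtain ⟨w, rfl⟩ := hgf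
  obtain rfl | hF := eq_or_ne F 0
  · exact dvd_zero G
  have hw : w ≠ 0 := by
    rintro rfl
    exact hF (hf.eq_zero hx (by simp))
  obtain ⟨k, W, hW, hW0⟩ := exists_ne_zero hx.span_range_eq hw
  have hGW := hg.mul hx.span_range_eq hW
  obtain rfl : m = n + k := by
    exact_mod_cast (hf.ord_eq hx hF).symm.trans (hGW.ord_eq hx (mul_ne_zero hG hW0))
  exact ⟨W, hf.unique hx hGW⟩

end IsLeadingForm

end RegularSystem

section RegularLocalRing

variable {R : Type*} [CommRing R] [IsRegularLocalRing R]

variable (R) in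
theorem exists_isRegularSystemOfParameters :
    ∃ (d : ℕ) (x : Fin d → R), IsRegularSystemOfParameters x := by
  have hfg : (maximalIdeal R).FG := IsNoetherian.noetherian _
  obtain ⟨s, hs, hspan⟩ := Submodule.FG.exists_span_set_encard_eq_spanFinrank hfg
  have hfin : s.Finite := Set.encard_ne_top_iff.1 (hs ▸ ENat.natCast_ne_top _)
  obtain ⟨d, x, hinj, rfl⟩ := hfin.fin_param
  refine ⟨d, x, hspan, ?_⟩
  have hheight : ((maximalIdeal R).spanFinrank : ℕ∞) = (maximalIdeal R).height := by
    have := IsRegularLocalRing.spanFinrank_maximalIdeal (R := R)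
    rw [← maximalIdeal_height_eq_ringKrullDim] at this
    exact_mod_cast this
  rw [← hheight, ← hs, ← Set.image_univ, hinj.encard_image, Set.encard_univ,
    ENat.card_eq_coe_natCard]

theorem ord_mul (f g : R) : ord (f * g) = ord f + ord g := by
  obtain rfl | hf := eq_or_ne f 0
  · simp
  obtain rfl | hg := eq_or_ne g 0
  · simp
  obtain ⟨d, x, hx⟩ := exists_isRegularSystemOfParameters R
  obtain ⟨m, F, hF, hF0⟩ := IsLeadingForm.exists_ne_zero hx.span_range_eq hf
  obtain ⟨n, G, hG, hG0⟩ := IsLeadingForm.exists_ne_zero hx.span_range_eq hg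
  rw [hF.ord_eq hx hF0, hG.ord_eq hx hG0,
    (hF.mul hx.span_range_eq hG).ord_eq hx (mul_ne_zero hF0 hG0), Nat.cast_add]

end RegularLocalRing

end LeadingForms

/-! ### Normality of regular local rings -/

section Normality

open MvPolynomial

theorem dvd_of_forall_pow_dvd_mul_pow {A : Type*} [CommRing A] [IsDomain A] [IsNoetherianRing A]
    [IsIntegrallyClosed A] {a b c : A} (hc : c ≠ 0) (h : ∀ k, a ^ k ∣ c * b ^ k) : a ∣ b := by
  obtain rfl | ha := eq_or_ne a 0
  · simpa [hc] using h 1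
  let K := FractionRing A
  have haK : algebraMap A K a ≠ 0 := by simpa using ha
  have hba : IsAlmostIntegral A (algebraMap A K b / algebraMap A K a) := by
    refine ⟨c, mem_nonZeroDivisors_of_ne_zero hc, fun k => ?_⟩
    obtain ⟨w, hw⟩ := h k
    refine ⟨w, ?_⟩
    rw [Algebra.smul_def, div_pow, ← mul_div_assoc, eq_div_iff (pow_ne_zero k haK),
      ← map_pow, ← map_pow, ← map_mul, ← map_mul, hw, mul_comm]
  obtain ⟨q, hq⟩ := IsIntegrallyClosed.isIntegral_iff.1 hba.isIntegral
  refine ⟨q, IsFractionRing.injective A K ?_⟩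
  rw [map_mul, hq, mul_div_cancel₀ _ haK]

theorem mem_of_forall_mem_sup_maximalIdeal_pow {A : Type*} [CommRing A] [IsLocalRing A]
    [IsNoetherianRing A] {J : Ideal A} {f : A} (h : ∀ n, f ∈ J ⊔ maximalIdeal A ^ n) : f ∈ J := by
  rw [← Ideal.Quotient.eq_zero_iff_mem, ← Submodule.mem_bot A,
    ← Ideal.iInf_pow_smul_eq_bot_of_isLocalRing (M := A ⧸ J) (maximalIdeal A)
      (maximalIdeal.isMaximal A).ne_top, Submodule.mem_iInf]
  intro n
  obtain ⟨j, hj, y, hy, rfl⟩ := Submodule.mem_sup.1 (h n)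
  rw [map_add, Ideal.Quotient.eq_zero_iff_mem.2 hj, zero_add, ← mul_one y, map_mul]
  exact Submodule.smul_mem_smul hy (Submodule.mem_top (x := (1 : A ⧸ J)))

theorem exists_isHomogeneous_eq_mul_of_dvd {k ι : Type*} [CommRing k] {F H : MvPolynomial ι k}
    {m n : ℕ} (hF : F.IsHomogeneous n) (hH : H.IsHomogeneous m) (hdvd : H ∣ F) (h0 : F ≠ 0) :
    ∃ e, n = m + e ∧ ∃ G : MvPolynomial ι k, G.IsHomogeneous e ∧ F = H * G := by
  obtain ⟨G, rfl⟩ := hdvd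
  have hsum : H * G = ∑ i ∈ Finset.range (G.totalDegree + 1),
      if m + i = n then H * homogeneousComponent i G else 0 := by
    conv_lhs => rw [← homogeneousComponent_eq_self hF, ← sum_homogeneousComponent G,
      Finset.mul_sum, map_sum]
    refine Finset.sum_congr rfl fun i _ => ?_
    rw [homogeneousComponent_of_mem (m := n) (n := m + i)
      (hH.mul (homogeneousComponent_isHomogeneous i G))]
    simp only [eq_comm]
  obtain ⟨i, -, hi⟩ := Finset.exists_ne_zero_of_sum_ne_zero (hsum ▸ h0)
  obtain ⟨rfl, -⟩ := ite_ne_right_iff.1 hi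
  refine ⟨i, rfl, homogeneousComponent i G, homogeneousComponent_isHomogeneous i G, ?_⟩
  rw [hsum]
  simp only [add_right_inj]
  rw [Finset.sum_ite_eq', ite_eq_left_iff, Finset.mem_range, Nat.lt_succ_iff, not_le]
  intro hlt
  rw [homogeneousComponent_eq_zero _ _ hlt, mul_zero]

section RegularLocalDomain

variable {R K : Type*} [CommRing R] [IsRegularLocalRing R] [Field K] [Algebra R K]
  [IsFractionRing R K] {ι : Type*} [Finite ι] {x : ι → R} {f h : R}

theorem IsLeadingForm.dvd_of_isIntegral {m n : ℕ} {F H : MvPolynomial ι (ResidueField R)}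
    (hx : IsRegularSystemOfParameters x) (hf : IsLeadingForm x n f F) (hh : IsLeadingForm x m h H)
    (hH : H ≠ 0) (hh0 : h ≠ 0) (hint : IsIntegral R (algebraMap R K f / algebraMap R K h)) :
    H ∣ F := by
  obtain ⟨c, hc, hck⟩ := hint.isAlmostIntegral
  have hhK : algebraMap R K h ≠ 0 := by simpa using hh0
  obtain ⟨k, C, hC, hC0⟩ := exists_ne_zero hx.span_range_eq (nonZeroDivisors.ne_zero hc)
  refine dvd_of_forall_pow_dvd_mul_pow hC0 fun i => ?_
  refine (hC.mul hx.span_range_eq (hf.pow hx.span_range_eq i)).dvd_of_dvd hx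
    (hh.pow hx.span_range_eq i) (pow_ne_zero i hH) ?_
  obtain ⟨w, hw⟩ := hck i
  refine ⟨w, IsFractionRing.injective R K ?_⟩
  rw [Algebra.smul_def, div_pow] at hw
  rw [map_mul, map_mul, map_pow, map_pow, hw, ← mul_div_assoc,
    mul_div_cancel₀ _ (pow_ne_zero i hhK)]

theorem exists_sub_mul_mem_maximalIdeal_pow (hh : h ≠ 0)
    (hint : IsIntegral R (algebraMap R K f / algebraMap R K h)) (n : ℕ) :
    ∃ q, f - h * q ∈ maximalIdeal R ^ n := by
  obtain ⟨d, x, hx⟩ := exists_isRegularSystemOfParameters R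
  obtain ⟨m, H, hH, hH0⟩ := IsLeadingForm.exists_ne_zero hx.span_range_eq hh
  have hhK : algebraMap R K h ≠ 0 := by simpa using hh
  induction n with
  | zero => exact ⟨0, by simp⟩
  | succ n ih =>
    obtain ⟨q, hq⟩ := ih
    obtain ⟨F, hF⟩ := IsLeadingForm.exists_of_mem hx.span_range_eq hq
    obtain rfl | hF0 := eq_or_ne F 0
    · exact ⟨q, hF.mem_succ_of_zero hx.span_range_eq⟩
    have hint' : IsIntegral R (algebraMap R K (f - h * q) / algebraMap R K h) := by
      rw [map_sub, map_mul, sub_div, mul_div_cancel_left₀ _ hhK]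
      exact hint.sub isIntegral_algebraMap
    obtain ⟨e, rfl, G, hG, rfl⟩ := exists_isHomogeneous_eq_mul_of_dvd hF.isHomogeneous
      hH.isHomogeneous (hF.dvd_of_isIntegral hx hH hH0 hh hint') hF0
    obtain ⟨q', hq'⟩ := IsLeadingForm.exists_of_isHomogeneous x hG
    refine ⟨q + q', ?_⟩
    have hsub := hF.sub (hH.mul hx.span_range_eq hq')
    rw [sub_self, sub_sub, ← mul_add] at hsub
    exact hsub.mem_succ_of_zero hx.span_range_eq

variable (R) in
theorem isIntegrallyClosed_of_isRegularLocalRing [IsDomain R] : IsIntegrallyClosed R := by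
  refine (isIntegrallyClosed_iff (FractionRing R)).2 fun {z} hz => ?_
  obtain ⟨f, h, hh, rfl⟩ := IsFractionRing.div_surjective (A := R) z
  have hh0 : h ≠ 0 := nonZeroDivisors.ne_zero hh
  have hfh : f ∈ Ideal.span {h} := mem_of_forall_mem_sup_maximalIdeal_pow fun n => by
    obtain ⟨q, hq⟩ := exists_sub_mul_mem_maximalIdeal_pow hh0 hz n
    exact Submodule.mem_sup.2
      ⟨h * q, Ideal.mul_mem_right q _ (Ideal.mem_span_singleton_self h), _, hq, by ring⟩
  obtain ⟨q, rfl⟩ := Ideal.mem_span_singleton'.1 hfh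
  exact ⟨q, by rw [map_mul, mul_div_cancel_right₀ _ (by simpa using hh0)]⟩

end RegularLocalDomain

end Normality

/-! ### The order valuation -/

section OrderValuations

open WithZero

section ExpNeg

/-- The order-reversing embedding `n ↦ exp (-n)`, `⊤ ↦ 0`, which turns an order function into a
valuation. -/
def expNeg : ℕ∞ → ℤᵐ⁰ := ENat.recTopCoe 0 fun n => exp (-(n : ℤ))

@[simp]
theorem expNeg_top : expNeg ⊤ = 0 := rfl

@[simp]
theorem expNeg_natCast (n : ℕ) : expNeg n = exp (-(n : ℤ)) := rfl

theorem expNeg_add (a b : ℕ∞) : expNeg (a + b) = expNeg a * expNeg b := by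
  cases a with
  | top => simp
  | coe a =>
    cases b with
    | top => simp
    | coe b =>
      rw [← Nat.cast_add, expNeg_natCast, expNeg_natCast, expNeg_natCast, ← exp_add,
        Nat.cast_add, neg_add]

theorem expNeg_le_expNeg_iff {a b : ℕ∞} : expNeg a ≤ expNeg b ↔ b ≤ a := by
  cases a <;> cases b <;> simp [-exp_neg]

end ExpNeg

section OrderValuation

variable (R : Type*) [CommRing R] [IsRegularLocalRing R]

/-- The order valuation of a regular local ring, written multiplicatively. -/
def orderValuation : Valuation R ℤᵐ⁰ where
  toFun f := expNeg (ord f)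
  map_zero' := by simp
  map_one' := by simpa using expNeg_natCast 0
  map_mul' f g := by rw [ord_mul, expNeg_add]
  map_add_le_max' f g := by
    have hanti : Antitone expNeg := fun _ _ => expNeg_le_expNeg_iff.2
    rw [← hanti.map_min, expNeg_le_expNeg_iff]
    exact min_ord_le_ord_add f g

open scoped nonZeroDivisors in
theorem nonZeroDivisors_le_primeCompl_supp_orderValuation :
    R⁰ ≤ (orderValuation R).supp.primeCompl := by
  intro f hf h
  have hord : ord f = ⊤ :=
    top_le_iff.1 (expNeg_le_expNeg_iff.1 (le_of_eq h))
  exact nonZeroDivisors.ne_zero hf (ord_eq_top_iff.1 hord)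

variable (K : Type*) [Field K] [Algebra R K] [IsFractionRing R K]

/-- The order valuation of a regular local domain, extended to the fraction field. -/
def ordVal : Valuation K ℤᵐ⁰ :=
  (orderValuation R).extendToLocalization (nonZeroDivisors_le_primeCompl_supp_orderValuation R) K

variable {R K}

theorem ordVal_algebraMap (f : R) : ordVal R K (algebraMap R K f) = expNeg (ord f) :=
  Valuation.extendToLocalization_apply_map_apply ..

theorem ordVal_algebraMap_le_iff {f : R} {n : ℕ} :
    ordVal R K (algebraMap R K f) ≤ exp (-(n : ℤ)) ↔ f ∈ maximalIdeal R ^ n := by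
  rw [ordVal_algebraMap, ← expNeg_natCast, expNeg_le_expNeg_iff, natCast_le_ord_iff]

theorem ordVal_algebraMap_eq {f : R} {n : ℕ} (h : f ∈ maximalIdeal R ^ n)
    (h' : f ∉ maximalIdeal R ^ (n + 1)) : ordVal R K (algebraMap R K f) = exp (-(n : ℤ)) := by
  rw [ordVal_algebraMap, ord_eq_natCast_iff.2 ⟨h, h'⟩, expNeg_natCast]

theorem mem_ordValuationRing_iff {z : K} : z ∈ ordValuationRing R K ↔ ordVal R K z ≤ 1 := by
  have hdiv (f g : R) (hg : g ≠ 0) :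
      ord g ≤ ord f ↔ ordVal R K (algebraMap R K f / algebraMap R K g) ≤ 1 := by
    have hg0 : ordVal R K (algebraMap R K g) ≠ 0 := by simpa using hg
    rw [map_div₀, div_le_one₀ (zero_lt_iff.2 hg0), ordVal_algebraMap, ordVal_algebraMap,
      expNeg_le_expNeg_iff]
  constructor
  · rintro ⟨f, g, hg, hle, rfl⟩
    exact (hdiv f g hg).1 hle
  · intro hz
    obtain ⟨f, g, hg, rfl⟩ := IsFractionRing.div_surjective (A := R) z
    exact ⟨f, g, nonZeroDivisors.ne_zero hg, (hdiv f g (nonZeroDivisors.ne_zero hg)).2 hz, rfl⟩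

end OrderValuation

end OrderValuations

/-! ### Localizations, centers and charts -/

section Localizations

section Subalgebra

variable {R K : Type*} [CommRing R] [Field K] [Algebra R K]

theorem algebraMap_div_mem_of_mem_pow {S : Subalgebra R K} {I : Ideal R} {a : K}
    (h : ∀ b ∈ I, algebraMap R K b / a ∈ S) {k : ℕ} {f : R} (hf : f ∈ I ^ k) :
    algebraMap R K f / a ^ k ∈ S := by
  induction k generalizing f with
  | zero => simp
  | succ k ih =>
    rw [pow_succ] at hf
    refine Submodule.mul_induction_on hf (fun m hm n hn => ?_) fun m n hm hn => ?_
    · rw [map_mul, pow_succ, ← div_mul_div_comm]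
      exact mul_mem (ih hm) (h n hn)
    · rw [map_add, add_div]
      exact add_mem hm hn

theorem isIntegral_of_le {A B : Subalgebra R K} (h : A ≤ B) {z : K} (hz : IsIntegral A z) :
    IsIntegral B z :=
  RingHom.IsIntegralElem.of_comp (f := (Subalgebra.inclusion h).toRingHom) (g := algebraMap B K) hz

theorem isIntegrallyClosedIn_iff_forall_mem {S : Subalgebra R K} :
    IsIntegrallyClosedIn S K ↔ ∀ z : K, IsIntegral S z → z ∈ S :=
  Subring.isIntegrallyClosedIn_iff (S := S.toSubring)

theorem mem_of_isIntegral {S : Subalgebra R K} [hS : IsIntegrallyClosedIn S K] {z : K}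
    (hz : IsIntegral S z) : z ∈ S :=
  isIntegrallyClosedIn_iff_forall_mem.1 hS z hz

theorem valuation_le_one_of_isIntegral {Γ : Type*} [LinearOrderedCommGroupWithZero Γ]
    {v : Valuation K Γ} {B : Subalgebra R K} (hB : ∀ z ∈ B, v z ≤ 1) {z : K}
    (hz : IsIntegral B z) : v z ≤ 1 := by
  have h1 : IsIntegral v.integer z :=
    RingHom.IsIntegralElem.of_comp
      (f := ((algebraMap B K).codRestrict v.integer fun b => hB b b.2))
      (g := algebraMap v.integer K) hz
  exact (Valuation.integer.integers v).mem_of_integral h1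

theorem isUnit_iff_inv_mem {S : Subalgebra R K} {z : S} :
    IsUnit z ↔ (z : K) ≠ 0 ∧ (z : K)⁻¹ ∈ S := by
  constructor
  · rintro ⟨u, rfl⟩
    have h : ((u : S) : K) * ((u⁻¹ : Sˣ) : S) = 1 := congrArg Subtype.val u.mul_inv
    exact ⟨left_ne_zero_of_mul_eq_one h, inv_eq_of_mul_eq_one_right h ▸ SetLike.coe_mem _⟩
  · rintro ⟨h0, h⟩
    exact IsUnit.of_mul_eq_one ⟨_, h⟩ (Subtype.ext (mul_inv_cancel₀ h0))

end Subalgebra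

section LocalizationAt

variable {R K : Type*} [CommRing R] [Field K] [Algebra R K]

theorem coe_ne_zero_of_notMem {B : Subalgebra R K} {P : Ideal B} {c : B} (hc : c ∉ P) :
    (c : K) ≠ 0 := fun h0 =>
  hc (by rw [show c = 0 from Subtype.ext h0]; exact P.zero_mem)

variable (B : Subalgebra R K) (P : Ideal B) [hP : P.IsPrime]

theorem le_localizationAt : B ≤ localizationAt B P := fun z hz =>
  ⟨⟨z, hz⟩, 1, fun h => hP.ne_top ((Ideal.eq_top_iff_one P).2 h), by simp⟩

instance localizationAt_algebra : Algebra B (localizationAt B P) :=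
  (Subalgebra.inclusion (le_localizationAt B P)).toAlgebra

instance localizationAt_isScalarTower : IsScalarTower B (localizationAt B P) K :=
  .of_algebraMap_eq fun _ => rfl

variable {B P}

theorem inv_mem_localizationAt {c : B} (hc : c ∉ P) : (c : K)⁻¹ ∈ localizationAt B P :=
  ⟨1, c, hc, by simp⟩

instance isLocalization_localizationAt : IsLocalization.AtPrime (localizationAt B P) P where
  map_units c := isUnit_iff_inv_mem.2
    ⟨coe_ne_zero_of_notMem (P := P) c.2, inv_mem_localizationAt c.2⟩
  surj := by
    rintro ⟨_, b, c, hc, rfl⟩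
    exact ⟨(b, ⟨c, hc⟩), Subtype.ext (div_mul_cancel₀ _ (coe_ne_zero_of_notMem hc))⟩
  exists_of_eq {b b'} h := ⟨1, congrArg _ (Subalgebra.inclusion_injective _ h)⟩

instance isLocalRing_localizationAt : IsLocalRing (localizationAt B P) :=
  IsLocalization.AtPrime.isLocalRing _ P

instance isIntegrallyClosedIn_localizationAt [IsIntegrallyClosedIn B K] :
    IsIntegrallyClosedIn (localizationAt B P) K := by
  refine isIntegrallyClosedIn_iff_forall_mem.2 fun z hz => ?_
  obtain ⟨⟨c, hc⟩, h⟩ := hz.exists_multiple_integral_of_isLocalization P.primeCompl z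
  exact ⟨⟨_, mem_of_isIntegral h⟩, c, hc, (mul_div_cancel_left₀ z (coe_ne_zero_of_notMem hc)).symm⟩

end LocalizationAt

section Center

variable {R K : Type*} [CommRing R] [Field K] [Algebra R K] {Γ : Type*}
  [LinearOrderedCommGroupWithZero Γ]

/-- The center on `B` of a valuation that is at most `1` on `B`. -/
def center (v : Valuation K Γ) (B : Subalgebra R K) (hB : ∀ z ∈ B, v z ≤ 1) : Ideal B where
  carrier := {b | v b < 1}
  zero_mem' := by simp
  add_mem' {a b} ha hb := (v.map_add _ _).trans_lt (max_lt ha hb)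
  smul_mem' a b hb := by
    change v (a * b : K) < 1
    rw [map_mul]
    exact mul_lt_one_of_nonneg_of_lt_one_right (hB a a.2) zero_le hb

variable {v : Valuation K Γ} {B : Subalgebra R K} {hB : ∀ z ∈ B, v z ≤ 1}

theorem mem_center {b : B} : b ∈ center v B hB ↔ v b < 1 := Iff.rfl

theorem notMem_center {b : B} : b ∉ center v B hB ↔ v b = 1 := by
  rw [mem_center, not_lt]
  exact ⟨fun h => le_antisymm (hB b b.2) h, fun h => h.ge⟩

instance center_isPrime : (center v B hB).IsPrime where
  ne_top' h := by
    have h1 := (Ideal.eq_top_iff_one _).1 h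
    simp [mem_center] at h1
  mem_or_mem' {a b} h := by
    by_contra! hab
    rw [notMem_center, notMem_center] at hab
    simp [mem_center, hab.1, hab.2] at h

theorem mem_localizationAt_center {z : K} :
    z ∈ localizationAt B (center v B hB) ↔ ∃ b ∈ B, ∃ c ∈ B, v c = 1 ∧ z = b / c := by
  constructor
  · rintro ⟨b, c, hc, rfl⟩
    exact ⟨b, b.2, c, c.2, notMem_center.1 hc, rfl⟩
  · rintro ⟨b, hb, c, hc, hv, rfl⟩
    exact ⟨⟨b, hb⟩, ⟨c, hc⟩, notMem_center.2 hv, rfl⟩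

/-- The valuation ring of `v` contains `S`, and its maximal ideal meets `S` in the nonunits. -/
structure ValuationDominates (v : Valuation K Γ) (S : Subalgebra R K) : Prop where
  le_one : ∀ z ∈ S, v z ≤ 1
  inv_mem : ∀ z ∈ S, v z = 1 → z⁻¹ ∈ S

theorem ValuationDominates.isUnit_iff {S : Subalgebra R K} (h : ValuationDominates v S) {z : S} :
    IsUnit z ↔ v (z : K) = 1 := by
  rw [isUnit_iff_inv_mem]
  constructor
  · rintro ⟨h0, h1⟩
    refine le_antisymm (h.le_one _ z.2) ?_
    have hinv := h.le_one _ h1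
    rwa [map_inv₀, inv_le_one₀ (zero_lt_iff.2 ((Valuation.ne_zero_iff v).2 h0))] at hinv
  · intro h1
    exact ⟨(Valuation.ne_zero_iff v).1 (h1 ▸ one_ne_zero), h.inv_mem _ z.2 h1⟩

theorem ValuationDominates.mem_maximalIdeal_iff {S : Subalgebra R K} [IsLocalRing S]
    (h : ValuationDominates v S) {z : S} : z ∈ maximalIdeal S ↔ v (z : K) < 1 := by
  rw [mem_maximalIdeal, mem_nonunits_iff, h.isUnit_iff, lt_iff_le_and_ne,
    and_iff_right (h.le_one _ z.2)]

theorem valuationDominates_localizationAt_center :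
    ValuationDominates v (localizationAt B (center v B hB)) where
  le_one := by
    intro z hz
    obtain ⟨b, hb, c, -, hv, rfl⟩ := mem_localizationAt_center.1 hz
    rw [map_div₀, hv, div_one]
    exact hB b hb
  inv_mem := by
    intro z hz h1
    obtain ⟨b, hb, c, hc, hv, rfl⟩ := mem_localizationAt_center.1 hz
    rw [map_div₀, hv, div_one] at h1
    exact mem_localizationAt_center.2 ⟨c, hc, b, hb, h1, inv_div _ _⟩

theorem ValuationDominates.lt_one_of_dominates [IsLocalRing R] {S : Subalgebra R K}
    (h : ValuationDominates v S) (hdom : Dominates S) {y : R} (hy : y ∈ maximalIdeal R) :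
    v (algebraMap R K y) < 1 :=
  lt_of_le_of_ne (h.le_one _ (S.algebraMap_mem y)) fun h1 =>
    (mem_maximalIdeal y).1 hy (hdom.map_nonunit y (h.isUnit_iff.2 h1))

theorem exists_valuationSubring_dominates {S : Subalgebra R K} [hloc : IsLocalRing S]
    [IsIntegrallyClosedIn S K] {u : K} (hu : u ∉ S) :
    ∃ W : ValuationSubring K, ValuationDominates W.valuation S ∧ u ∉ W := by
  let A : LocalSubring K := { toSubring := S.toSubring, isLocalRing := hloc }
  have hA : IsIntegrallyClosedIn A.toSubring K := ‹IsIntegrallyClosedIn S K›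
  obtain ⟨W, ⟨hle, hlocal⟩, huW⟩ :=
    LocalSubring.exists_le_valuationSubring_of_isIntegrallyClosedIn (R := A) hu
  refine ⟨W, ⟨fun z hz => (W.valuation_le_one_iff z).2 (hle hz), fun z hz h1 => ?_⟩, huW⟩
  have hunit : IsUnit (Subring.inclusion hle ⟨z, hz⟩) :=
    (W.valuation_eq_one_iff (⟨z, hle hz⟩ : W)).2 h1
  exact (isUnit_iff_inv_mem (z := (⟨z, hz⟩ : S)).1 (hlocal.map_nonunit _ hunit)).2

end Center

section Charts

variable {R K : Type*} [CommRing R] [Field K] [Algebra R K] {I : Ideal R} {a : R}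

theorem mem_blowupChart (ha : a ∈ I) (ha0 : algebraMap R K a ≠ 0) {z : K} :
    z ∈ blowupChart K I a ↔ ∃ k, ∃ f ∈ I ^ k, z = algebraMap R K f / algebraMap R K a ^ k := by
  constructor
  · intro hz
    induction hz using Algebra.adjoin_induction with
    | mem x hx =>
      obtain ⟨b, hb, rfl⟩ := hx
      exact ⟨1, b, by simpa using hb, by simp⟩
    | algebraMap r => exact ⟨0, r, by simp, by simp⟩
    | add x y _ _ hx hy =>
      obtain ⟨k, f, hf, rfl⟩ := hx
      obtain ⟨l, g, hg, rfl⟩ := hy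
      refine ⟨k + l, f * a ^ l + a ^ k * g, add_mem ?_ ?_, ?_⟩
      · rw [pow_add]; exact Ideal.mul_mem_mul hf (Ideal.pow_mem_pow ha l)
      · rw [pow_add]; exact Ideal.mul_mem_mul (Ideal.pow_mem_pow ha k) hg
      · rw [div_add_div _ _ (pow_ne_zero k ha0) (pow_ne_zero l ha0), pow_add]
        simp
    | mul x y _ _ hx hy =>
      obtain ⟨k, f, hf, rfl⟩ := hx
      obtain ⟨l, g, hg, rfl⟩ := hy
      refine ⟨k + l, f * g, pow_add I k l ▸ Ideal.mul_mem_mul hf hg, ?_⟩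
      rw [div_mul_div_comm, map_mul, pow_add]
  · rintro ⟨k, f, hf, rfl⟩
    exact algebraMap_div_mem_of_mem_pow (S := blowupChart K I a)
      (fun b hb => Algebra.subset_adjoin ⟨b, hb, rfl⟩) hf

theorem blowupChart_le_iff {S : Subalgebra R K} :
    blowupChart K I a ≤ S ↔ ∀ b ∈ I, algebraMap R K b / algebraMap R K a ∈ S := by
  rw [blowupChart, Algebra.adjoin_le_iff]
  constructor
  · exact fun h b hb => h ⟨b, hb, rfl⟩
  · rintro h _ ⟨b, hb, rfl⟩
    exact h b hb

theorem mem_normalizedBlowupChart {z : K} :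
    z ∈ normalizedBlowupChart K I a ↔ IsIntegral (blowupChart K I a) z := Iff.rfl

theorem blowupChart_le_normalizedBlowupChart :
    blowupChart K I a ≤ normalizedBlowupChart K I a := fun z hz =>
  mem_normalizedBlowupChart.2 (isIntegral_algebraMap (x := (⟨z, hz⟩ : blowupChart K I a)))

instance isIntegrallyClosedIn_normalizedBlowupChart :
    IsIntegrallyClosedIn (normalizedBlowupChart K I a) K :=
  inferInstanceAs (IsIntegrallyClosedIn (integralClosure (blowupChart K I a) K) K)

theorem normalizedBlowupChart_le {S : Subalgebra R K} [IsIntegrallyClosedIn S K]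
    (h : ∀ b ∈ I, algebraMap R K b / algebraMap R K a ∈ S) : normalizedBlowupChart K I a ≤ S :=
  fun _ hz => mem_of_isIntegral
    (isIntegral_of_le (blowupChart_le_iff.2 h) (mem_normalizedBlowupChart.1 hz))

theorem div_mem_localizationAt (P : Ideal (normalizedBlowupChart K I a)) [P.IsPrime] {b : R}
    (hb : b ∈ I) :
    algebraMap R K b / algebraMap R K a ∈ localizationAt (normalizedBlowupChart K I a) P :=
  blowupChart_le_iff.1 (blowupChart_le_normalizedBlowupChart.trans (le_localizationAt _ P)) b hb

/-- If `IT` is contained in `uT` and `a / u` is a unit of `T`, then `IT = aT`, so the point over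
which `I` is generated by `a` factors through `T`. -/
theorem localizationAt_normalizedBlowupChart_le {Γ : Type*} [LinearOrderedCommGroupWithZero Γ]
    {v : Valuation K Γ} {T : Subalgebra R K} [IsIntegrallyClosedIn T K]
    (hT : ValuationDominates v T) {u : K} (hu : ∀ b ∈ I, algebraMap R K b / u ∈ T)
    (hu0 : v u ≠ 0) (ha : a ∈ I) (hva : v (algebraMap R K a) = v u)
    {P : Ideal (normalizedBlowupChart K I a)} [P.IsPrime]
    (hP : ∀ z ∈ localizationAt (normalizedBlowupChart K I a) P, v z ≤ 1) :
    localizationAt (normalizedBlowupChart K I a) P ≤ T := by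
  have hinv : u / algebraMap R K a ∈ T := by
    simpa using hT.inv_mem _ (hu a ha) (by rw [map_div₀, hva, div_self hu0])
  have hB : normalizedBlowupChart K I a ≤ T := by
    refine normalizedBlowupChart_le fun b hb => ?_
    rw [← div_mul_div_cancel₀ ((Valuation.ne_zero_iff v).1 hu0)]
    exact mul_mem (hu b hb) hinv
  rintro _ ⟨b, c, hc, rfl⟩
  have hvc : 0 < v (c : K) := zero_lt_iff.2 ((Valuation.ne_zero_iff v).2 (coe_ne_zero_of_notMem hc))
  have hc1 : v (c : K) = 1 := by
    refine le_antisymm (hP _ (le_localizationAt _ P c.2)) ?_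
    have hle := hP _ (inv_mem_localizationAt hc)
    rwa [map_inv₀, inv_le_one₀ hvc] at hle
  rw [div_eq_mul_inv]
  exact mul_mem (hB b.2) (hT.inv_mem _ (hB c.2) hc1)

end Charts

end Localizations

/-! ### Homogeneous prime avoidance -/

section HomogeneousPrimeAvoidance

open Finset

section HomogeneousPrimes

variable {R : Type*} [CommRing R] {m : Ideal R}

theorem pow_add_pow_mem {e d : ℕ} {F G : R} (hF : F ∈ m ^ e) (hG : G ∈ m ^ d) :
    F ^ d + G ^ e ∈ m ^ (d * e) := by
  refine add_mem ?_ ?_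
  · rw [mul_comm, pow_mul]
    exact Ideal.pow_mem_pow hF d
  · rw [pow_mul]
    exact Ideal.pow_mem_pow hG e

/-- The ideals `Q e` cut out, in the powers `mᵉ`, the homogeneous components of a homogeneous prime
ideal of the Rees algebra of `m`. -/
structure IsHomogeneousPrime (m : Ideal R) (Q : ℕ → Ideal R) : Prop where
  one_notMem : 1 ∉ Q 0
  mul_mem_iff {e d : ℕ} {F G : R} (hF : F ∈ m ^ e) (hG : G ∈ m ^ d) :
    F * G ∈ Q (e + d) ↔ F ∈ Q e ∨ G ∈ Q d

namespace IsHomogeneousPrime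

variable {Q : ℕ → Ideal R} (hQ : IsHomogeneousPrime m Q)

include hQ

theorem prod_mem_iff {ι : Type*} {s : Finset ι} {e : ι → ℕ} {F : ι → R}
    (hF : ∀ i ∈ s, F i ∈ m ^ e i) :
    ∏ i ∈ s, F i ∈ Q (∑ i ∈ s, e i) ↔ ∃ i ∈ s, F i ∈ Q (e i) := by
  classical
  induction s using Finset.induction_on with
  | empty => simpa using hQ.one_notMem
  | insert a s ha ih =>
    have hs := fun i hi => hF i (mem_insert_of_mem hi)
    have hprod : ∏ i ∈ s, F i ∈ m ^ ∑ i ∈ s, e i := by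
      rw [← prod_pow_eq_pow_sum]
      exact Ideal.prod_mem_prod hs
    rw [sum_insert ha, prod_insert ha, hQ.mul_mem_iff (hF a (mem_insert_self a s)) hprod, ih hs,
      exists_mem_insert]

theorem pow_mem_iff {e k : ℕ} (hk : 0 < k) {F : R} (hF : F ∈ m ^ e) :
    F ^ k ∈ Q (k * e) ↔ F ∈ Q e := by
  have hne : ∃ i, i < k := ⟨0, hk⟩
  simpa [hne] using hQ.prod_mem_iff (s := range k) (e := fun _ => e) fun _ _ => hF

theorem pow_add_pow_notMem {e d : ℕ} (he : 0 < e) (hd : 0 < d) {F G : R} (hF : F ∈ m ^ e)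
    (hG : G ∈ m ^ d) (h : F ∈ Q e ↔ G ∉ Q d) : F ^ d + G ^ e ∉ Q (d * e) := by
  have hFd : F ^ d ∈ Q (d * e) ↔ F ∈ Q e := hQ.pow_mem_iff hd hF
  have hGe : G ^ e ∈ Q (d * e) ↔ G ∈ Q d := mul_comm d e ▸ hQ.pow_mem_iff he hG
  by_cases hFQ : F ∈ Q e
  · rw [Submodule.add_mem_iff_right _ (hFd.2 hFQ), hGe]
    exact h.1 hFQ
  · rwa [Submodule.add_mem_iff_left _ (hGe.2 (by tauto)), hFd]

end IsHomogeneousPrime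

theorem exists_forall_notMem_of_isHomogeneousPrime {ι : Type*} {s : Finset ι}
    {Q : ι → ℕ → Ideal R} (hQ : ∀ i ∈ s, IsHomogeneousPrime m (Q i))
    (hm : ∀ i ∈ s, ∃ x ∈ m, x ∉ Q i 1) :
    ∃ e, 0 < e ∧ ∃ F ∈ m ^ e, ∀ i ∈ s, F ∉ Q i e := by
  classical
  induction s using Finset.strongInduction with
  | H s ih =>
    rcases s.eq_empty_or_nonempty with rfl | ⟨i₀, hi₀⟩
    · exact ⟨1, one_pos, 0, zero_mem _, by simp⟩
    have hex (i) (hi : i ∈ s) : ∃ e, 0 < e ∧ ∃ F ∈ m ^ e, ∀ j ∈ s.erase i, F ∉ Q j e :=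
      ih _ (erase_ssubset hi) (fun j h => hQ j (mem_of_mem_erase h))
        fun j h => hm j (mem_of_mem_erase h)
    choose! e he F hF havoid using hex
    by_cases hgood : ∃ i ∈ s, F i ∉ Q i (e i)
    · obtain ⟨i, hi, h⟩ := hgood
      refine ⟨e i, he i hi, F i, hF i hi, fun j hj => ?_⟩
      obtain rfl | hji := eq_or_ne j i
      exacts [h, havoid i hi j (mem_erase.2 ⟨hji, hj⟩)]
    push Not at hgood
    obtain ⟨x, hx, hxQ⟩ := hm i₀ hi₀
    have hx1 : x ∈ m ^ 1 := by rwa [pow_one]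
    have hFs (j) (hj : j ∈ s.erase i₀) : F j ∈ m ^ e j := hF j (mem_of_mem_erase hj)
    have hprod : ∏ j ∈ s.erase i₀, F j ∈ m ^ ∑ j ∈ s.erase i₀, e j := by
      rw [← prod_pow_eq_pow_sum]
      exact Ideal.prod_mem_prod hFs
    have hG : x * ∏ j ∈ s.erase i₀, F j ∈ m ^ (1 + ∑ j ∈ s.erase i₀, e j) :=
      pow_add m 1 _ ▸ Ideal.mul_mem_mul hx1 hprod
    have hd : 0 < 1 + ∑ j ∈ s.erase i₀, e j := Nat.add_pos_left one_pos _
    refine ⟨_, Nat.mul_pos hd (he i₀ hi₀), _, pow_add_pow_mem (hF i₀ hi₀) hG, fun i hi => ?_⟩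
    refine (hQ i hi).pow_add_pow_notMem (he i₀ hi₀) hd (hF i₀ hi₀) hG ?_
    rw [(hQ i hi).mul_mem_iff hx1 hprod, (hQ i hi).prod_mem_iff hFs]
    obtain rfl | hii := eq_or_ne i i₀
    · refine iff_of_true (hgood i hi) (not_or.2 ⟨hxQ, ?_⟩)
      rintro ⟨j, hj, h⟩
      exact havoid j (mem_of_mem_erase hj) i (mem_erase.2 ⟨(ne_of_mem_erase hj).symm, hi⟩) h
    · have hi' : i ∈ s.erase i₀ := mem_erase.2 ⟨hii, hi⟩
      exact iff_of_false (havoid i₀ hi₀ i hi') (not_not.2 (Or.inr ⟨i, hi', hgood i hi⟩))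

end HomogeneousPrimes

section PrincipalExtension

variable {R T : Type*} [CommRing R] [CommRing T] [Algebra R T] {m : Ideal R} {x : T}

theorem exists_algebraMap_eq_mul_pow (hx : m.map (algebraMap R T) = Ideal.span {x}) {e : ℕ} {F : R}
    (hF : F ∈ m ^ e) : ∃ u, algebraMap R T F = u * x ^ e := by
  have hmem := Ideal.mem_map_of_mem (algebraMap R T) hF
  rw [Ideal.map_pow, hx, Ideal.span_singleton_pow, Ideal.mem_span_singleton'] at hmem
  obtain ⟨u, hu⟩ := hmem
  exact ⟨u, hu.symm⟩

variable [IsDomain T]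

theorem mul_pow_mem_mul_map_pow_iff (hx : m.map (algebraMap R T) = Ideal.span {x}) (hx0 : x ≠ 0)
    {p : Ideal T} {e : ℕ} {u : T} : u * x ^ e ∈ p * m.map (algebraMap R T) ^ e ↔ u ∈ p := by
  rw [hx, Ideal.span_singleton_pow, Ideal.mem_mul_span_singleton]
  simp [pow_ne_zero e hx0]

theorem isHomogeneousPrime_comap (hx : m.map (algebraMap R T) = Ideal.span {x}) (hx0 : x ≠ 0)
    (p : Ideal T) [hp : p.IsPrime] :
    IsHomogeneousPrime m fun e => (p * m.map (algebraMap R T) ^ e).comap (algebraMap R T) where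
  one_notMem := by simpa using (Ideal.ne_top_iff_one p).1 hp.ne_top
  mul_mem_iff {e d F G} hF hG := by
    obtain ⟨u, hu⟩ := exists_algebraMap_eq_mul_pow hx hF
    obtain ⟨w, hw⟩ := exists_algebraMap_eq_mul_pow hx hG
    rw [Ideal.mem_comap, Ideal.mem_comap, Ideal.mem_comap, map_mul, hu, hw, mul_mul_mul_comm,
      ← pow_add, mul_pow_mem_mul_map_pow_iff hx hx0, mul_pow_mem_mul_map_pow_iff hx hx0,
      mul_pow_mem_mul_map_pow_iff hx hx0, hp.mul_mem_iff_mem_or_mem]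

theorem exists_mem_algebraMap_notMem_mul_map (hx : m.map (algebraMap R T) = Ideal.span {x})
    (hx0 : x ≠ 0) {p : Ideal T} (hp : p ≠ ⊤) :
    ∃ y ∈ m, y ∉ (p * m.map (algebraMap R T) ^ 1).comap (algebraMap R T) := by
  by_contra! hall
  have hxm : 1 * x ^ 1 ∈ m.map (algebraMap R T) := by simp [hx]
  have h1 := Ideal.map_le_iff_le_comap.2 hall hxm
  rw [mul_pow_mem_mul_map_pow_iff hx hx0] at h1
  exact (Ideal.ne_top_iff_one p).1 hp h1

theorem map_pow_eq_span_singleton [IsLocalRing T] (hx : m.map (algebraMap R T) = Ideal.span {x})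
    (hx0 : x ≠ 0) {e : ℕ} {F : R} (hF : F ∈ m ^ e)
    (hFQ : algebraMap R T F ∉ maximalIdeal T * m.map (algebraMap R T) ^ e) :
    m.map (algebraMap R T) ^ e = Ideal.span {algebraMap R T F} := by
  obtain ⟨u, hu⟩ := exists_algebraMap_eq_mul_pow hx hF
  rw [hu, mul_pow_mem_mul_map_pow_iff hx hx0, notMem_maximalIdeal] at hFQ
  rw [hu, hx, Ideal.span_singleton_pow, Ideal.span_singleton_mul_left_unit hFQ]

end PrincipalExtension

theorem exists_forall_map_pow_eq_span {R ι : Type*} [CommRing R] {m : Ideal R} [Finite ι]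
    (T : ι → Type*) [∀ i, CommRing (T i)] [∀ i, IsDomain (T i)] [∀ i, Algebra R (T i)]
    [∀ i, IsLocalRing (T i)] (hm : ∀ i, (m.map (algebraMap R (T i))).IsPrincipal)
    (hm0 : ∀ i, m.map (algebraMap R (T i)) ≠ ⊥) :
    ∃ e, 0 < e ∧ ∃ F ∈ m ^ e,
      ∀ i, m.map (algebraMap R (T i)) ^ e = Ideal.span {algebraMap R (T i) F} := by
  have := Fintype.ofFinite ι
  choose x hx using fun i => (hm i).principal
  have hx0 (i) : x i ≠ 0 := fun h => hm0 i (by simp [hx i, h])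
  obtain ⟨e, he, F, hF, havoid⟩ := exists_forall_notMem_of_isHomogeneousPrime
    (fun i (_ : i ∈ univ) => isHomogeneousPrime_comap (hx i) (hx0 i) (maximalIdeal (T i)))
    fun i _ => exists_mem_algebraMap_notMem_mul_map (hx i) (hx0 i) Ideal.IsPrime.ne_top'
  exact ⟨e, he, F, hF, fun i => map_pow_eq_span_singleton (hx i) (hx0 i) hF (havoid i (mem_univ i))⟩

open scoped nonZeroDivisors in
theorem isPrincipal_of_pow_eq_span_singleton {A : Type*} [CommRing A] [IsDomain A] [IsLocalRing A]
    {J : Ideal A} {e : ℕ} (he : 0 < e) {F : A} (hF : F ≠ 0) (h : J ^ e = Ideal.span {F}) :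
    J.IsPrincipal := by
  have hfin : {M : Ideal A | M.IsMaximal}.Finite :=
    (Set.finite_singleton (maximalIdeal A)).subset fun M hM => eq_maximalIdeal hM
  refine Ideal.IsPrincipal.of_finite_maximals_of_isUnit hfin ((isUnit_pow_iff he.ne').1 ?_)
  rw [← FractionalIdeal.coeIdeal_pow, h]
  exact .of_mul_eq_one _ (FractionalIdeal.coe_ideal_span_singleton_mul_inv (FractionRing A) hF)

end HomogeneousPrimeAvoidance

/-! ### Local quadratic transforms -/

section QuadraticTransforms

open WithZero

section Blowup

variable {R K : Type*} [CommRing R] [Field K] [Algebra R K] {I : Ideal R} {T : Subalgebra R K}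

theorem isLocalRing_of_mem_blowup (hT : T ∈ blowup K I) : IsLocalRing T := by
  obtain ⟨a, -, -, P, hP, rfl⟩ := hT
  exact isLocalRing_localizationAt

theorem isPrincipal_map_of_mem_blowup [FaithfulSMul R K] (hT : T ∈ blowup K I) :
    (I.map (algebraMap R T)).IsPrincipal := by
  obtain ⟨a, ha, ha0, P, hP, rfl⟩ := hT
  refine ⟨algebraMap R _ a, le_antisymm (Ideal.map_le_iff_le_comap.2 fun b hb => ?_)
    ((Ideal.span_singleton_le_iff_mem _).2 (Ideal.mem_map_of_mem _ ha))⟩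
  have haK : algebraMap R K a ≠ 0 := by simpa using ha0
  exact Ideal.mem_span_singleton'.2 ⟨⟨_, blowupChart_le_iff.1 (le_localizationAt _ P) b hb⟩,
    Subtype.ext (div_mul_cancel₀ _ haK)⟩

theorem map_ne_bot_of_ne_bot [FaithfulSMul R K] (hI : I ≠ ⊥) : I.map (algebraMap R T) ≠ ⊥ :=
  (Ideal.map_eq_bot_iff_of_injective fun _ _ h =>
    FaithfulSMul.algebraMap_injective R K (congrArg Subtype.val h)).not.2 hI

theorem exists_le_span_singleton_mul_eq {A : Type*} [CommRing A] {a : A} {L M : Ideal A}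
    (h : L ≤ Ideal.span {a} * M) : ∃ J ≤ M, Ideal.span {a} * J = L := by
  refine ⟨M ⊓ Submodule.comap (LinearMap.mulLeft A a) L, inf_le_left, le_antisymm ?_ fun z hz => ?_⟩
  · rw [Ideal.span_singleton_mul_le_iff]
    exact fun z hz => hz.2
  · obtain ⟨y, hy, rfl⟩ := Ideal.mem_span_singleton_mul.1 (h hz)
    exact Ideal.mem_span_singleton_mul.2 ⟨y, ⟨hy, hz⟩, rfl⟩

theorem div_mem_of_map_pow_eq_span {e : ℕ} {F y : R} (hF0 : algebraMap R K F ≠ 0)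
    (h : I.map (algebraMap R T) ^ e = Ideal.span {algebraMap R T F}) (hy : y ∈ I ^ e) :
    algebraMap R K y / algebraMap R K F ∈ T := by
  have hyT := Ideal.mem_map_of_mem (algebraMap R T) hy
  rw [Ideal.map_pow, h] at hyT
  obtain ⟨t, ht⟩ := Ideal.mem_span_singleton'.1 hyT
  have htK : (t : K) * algebraMap R K F = algebraMap R K y := congrArg Subtype.val ht
  rw [← htK, mul_div_cancel_right₀ _ hF0]
  exact t.2

theorem isPrincipal_map_of_forall_div_mem [IsLocalRing T] {e : ℕ} (he : 0 < e) {F : R}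
    (hF : F ∈ I ^ e) (hF0 : algebraMap R K F ≠ 0)
    (h : ∀ y ∈ I ^ e, algebraMap R K y / algebraMap R K F ∈ T) :
    (I.map (algebraMap R T)).IsPrincipal := by
  refine isPrincipal_of_pow_eq_span_singleton he (F := algebraMap R T F)
    (fun h0 => hF0 (congrArg Subtype.val h0)) ?_
  rw [← Ideal.map_pow]
  refine le_antisymm (Ideal.map_le_iff_le_comap.2 fun y hy => ?_)
    ((Ideal.span_singleton_le_iff_mem _).2 (Ideal.mem_map_of_mem _ hF))
  exact Ideal.mem_span_singleton'.2 ⟨⟨_, h y hy⟩, Subtype.ext (div_mul_cancel₀ _ hF0)⟩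

theorem two_le_ringKrullDim_of_lt {T : Type*} [CommRing T] {p q r : Ideal T} [hp : p.IsPrime]
    [hq : q.IsPrime] [hr : r.IsPrime] (hpq : p < q) (hqr : q < r) : 2 ≤ ringKrullDim T := by
  let l : LTSeries (PrimeSpectrum T) :=
    { length := 2
      toFun := ![⟨p, hp⟩, ⟨q, hq⟩, ⟨r, hr⟩]
      step := by
        intro i
        fin_cases i
        exacts [hpq, hqr] }
  exact Order.LTSeries.length_le_krullDim l

end Blowup

section CenteredOnChart

variable {R K : Type*} [CommRing R] [IsLocalRing R] [Field K] [Algebra R K]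
  {Γ : Type*} [LinearOrderedCommGroupWithZero Γ] {v : Valuation K Γ}

/-- The valuation `v` is centered at the maximal ideal of `R`, and its center on the blowup of this
ideal lies on the chart given by `x`: this is so when `v` is largest at `x` on the maximal
ideal. -/
structure IsCenteredOnChart (v : Valuation K Γ) (x : R) : Prop where
  mem : x ∈ maximalIdeal R
  ne_zero : algebraMap R K x ≠ 0
  le : ∀ y ∈ maximalIdeal R, v (algebraMap R K y) ≤ v (algebraMap R K x)
  lt_one : v (algebraMap R K x) < 1

namespace IsCenteredOnChart

variable {x : R} (h : IsCenteredOnChart v x)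

include h

theorem valuation_pos : 0 < v (algebraMap R K x) :=
  zero_lt_iff.2 ((Valuation.ne_zero_iff v).2 h.ne_zero)

theorem le_one (r : R) : v (algebraMap R K r) ≤ 1 := by
  have hrx := h.le (r * x) (Ideal.mul_mem_left _ r h.mem)
  rwa [map_mul, map_mul, mul_le_iff_le_one_left h.valuation_pos] at hrx

theorem le_pow {k : ℕ} {y : R} (hy : y ∈ maximalIdeal R ^ k) :
    v (algebraMap R K y) ≤ v (algebraMap R K x) ^ k := by
  induction k generalizing y with
  | zero => simpa using h.le_one y
  | succ k ih =>
    rw [pow_succ] at hy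
    refine Submodule.mul_induction_on hy (fun a ha b hb => ?_) fun a b ha hb => ?_
    · rw [map_mul, map_mul, pow_succ]
      exact mul_le_mul' (ih ha) (h.le b hb)
    · rw [map_add]
      exact (v.map_add _ _).trans (max_le ha hb)

theorem notMem_sq : x ∉ maximalIdeal R ^ 2 := fun hx => by
  have hle := h.le_pow hx
  rw [pow_two] at hle
  exact (mul_lt_of_lt_one_left h.valuation_pos h.lt_one).not_ge hle

theorem valuation_le_one_of_mem_chart (z : K) (hz : z ∈ blowupChart K (maximalIdeal R) x) :
    v z ≤ 1 := by
  obtain ⟨k, f, hf, rfl⟩ := (mem_blowupChart h.mem h.ne_zero).1 hz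
  rw [map_div₀, map_pow]
  exact div_le_one_of_le₀ (h.le_pow hf) zero_le

/-- The local quadratic transform of `R` along `v`, that is, the local ring at the center of `v` on
the blowup of the maximal ideal. -/
def quadraticTransform : Subalgebra R K :=
  localizationAt _ (center v _ h.valuation_le_one_of_mem_chart)

theorem valuationDominates : ValuationDominates v h.quadraticTransform :=
  valuationDominates_localizationAt_center

instance isLocalRing_quadraticTransform : IsLocalRing h.quadraticTransform :=
  isLocalRing_localizationAt

theorem algebraMap_div_pow_mem {y : R} {k : ℕ} (hy : y ∈ maximalIdeal R ^ k) :
    algebraMap R K y / algebraMap R K x ^ k ∈ h.quadraticTransform :=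
  le_localizationAt _ _ ((mem_blowupChart h.mem h.ne_zero).2 ⟨k, y, hy, rfl⟩)

theorem algebraMap_mem_span_pow_mul {I : Ideal R} {r : ℕ} (hI : I ≤ maximalIdeal R ^ r) {y : R}
    (hy : y ∈ I) {M : Ideal h.quadraticTransform}
    (hM : (⟨_, h.algebraMap_div_pow_mem (hI hy)⟩ : h.quadraticTransform) ∈ M) :
    algebraMap R h.quadraticTransform y ∈
      Ideal.span {algebraMap R h.quadraticTransform x ^ r} * M :=
  Ideal.mem_span_singleton_mul.2
    ⟨_, hM, Subtype.ext (mul_div_cancel₀ _ (pow_ne_zero r h.ne_zero))⟩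

theorem dominates_quadraticTransform : Dominates h.quadraticTransform := by
  refine ⟨fun r hr => by_contra fun hn => ?_⟩
  have h1 : v (algebraMap R K r) = 1 := h.valuationDominates.isUnit_iff.1 hr
  exact ((h.le r ((mem_maximalIdeal r).2 hn)).trans_lt h.lt_one).ne h1

end IsCenteredOnChart

theorem exists_isCenteredOnChart [IsNoetherianRing R] [FaithfulSMul R K]
    (hm : maximalIdeal R ≠ ⊥) {S : Subalgebra R K} (hdom : Dominates S)
    (hv : ValuationDominates v S) : ∃ x : R, IsCenteredOnChart v x := by
  obtain ⟨s, hs⟩ : (maximalIdeal R).FG := IsNoetherian.noetherian _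
  have hne : s.Nonempty := by
    rw [Finset.nonempty_iff_ne_empty]
    rintro rfl
    exact hm (by rw [← hs]; simp)
  obtain ⟨x, hxs, hmax⟩ := s.exists_max_image (fun y => v (algebraMap R K y)) hne
  have hx : x ∈ maximalIdeal R := hs ▸ Ideal.subset_span hxs
  have hle : ∀ y ∈ maximalIdeal R, v (algebraMap R K y) ≤ v (algebraMap R K x) := by
    intro y hy
    rw [← hs] at hy
    induction hy using Submodule.span_induction with
    | mem y hy => exact hmax y hy
    | zero => simp
    | add a b _ _ ha hb => rw [map_add]; exact (v.map_add _ _).trans (max_le ha hb)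
    | smul a b _ hb =>
      rw [smul_eq_mul, map_mul, map_mul]
      exact (mul_le_of_le_one_left' (hv.le_one _ (S.algebraMap_mem a))).trans hb
  refine ⟨x, hx, fun hx0 => hm ((Submodule.eq_bot_iff _).2 fun y hy => ?_), hle,
    hv.lt_one_of_dominates hdom hx⟩
  have hy0 := hle y hy
  rw [hx0, map_zero, le_zero_iff, Valuation.zero_iff] at hy0
  simpa using hy0

end CenteredOnChart

variable {R K : Type*} [CommRing R] [IsRegularLocalRing R] [Field K] [Algebra R K]
  [IsFractionRing R K]

section OrderOnChart

theorem ordVal_lt_one_iff {z : K} : ordVal R K z < 1 ↔ ordVal R K z ≤ exp (-1 : ℤ) := by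
  by_cases h0 : ordVal R K z = 0
  · simp [h0]
  · rw [← exp_log h0, ← exp_zero, exp_lt_exp, exp_le_exp]
    omega

variable {x : R} (hx : x ∈ maximalIdeal R) (hx' : x ∉ maximalIdeal R ^ 2)

include hx hx'

theorem ordVal_algebraMap_eq_exp_neg_one : ordVal R K (algebraMap R K x) = exp (-1 : ℤ) :=
  ordVal_algebraMap_eq (n := 1) (by simpa using hx) hx'

theorem algebraMap_ne_zero_of_notMem_sq : algebraMap R K x ≠ 0 :=
  (Valuation.ne_zero_iff (ordVal R K)).1
    (ordVal_algebraMap_eq_exp_neg_one (K := K) hx hx' ▸ exp_ne_zero)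

theorem ordVal_div_pow_le_iff {f : R} {k l : ℕ} :
    ordVal R K (algebraMap R K f / algebraMap R K x ^ k) ≤ exp (-(l : ℤ)) ↔
      f ∈ maximalIdeal R ^ (k + l) := by
  rw [map_div₀, map_pow, ordVal_algebraMap_eq_exp_neg_one hx hx', ← exp_nsmul,
    div_le_iff₀ exp_pos, ← exp_add, ← ordVal_algebraMap_le_iff (K := K)]
  congr! 2
  push_cast
  rw [nsmul_eq_mul]
  ring

theorem ordVal_le_one_of_mem_blowupChart {z : K} (hz : z ∈ blowupChart K (maximalIdeal R) x) :
    ordVal R K z ≤ 1 := by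
  obtain ⟨k, f, hf, rfl⟩ := (mem_blowupChart hx (algebraMap_ne_zero_of_notMem_sq hx hx')).1 hz
  exact (ordVal_div_pow_le_iff hx hx' (l := 0)).2 hf

theorem div_mem_blowupChart {z : K} (hz : z ∈ blowupChart K (maximalIdeal R) x)
    (h : ordVal R K z < 1) : z / algebraMap R K x ∈ blowupChart K (maximalIdeal R) x := by
  have hx0 := algebraMap_ne_zero_of_notMem_sq (K := K) hx hx'
  rw [mem_blowupChart hx hx0] at hz ⊢
  obtain ⟨k, f, -, rfl⟩ := hz
  exact ⟨k + 1, f, (ordVal_div_pow_le_iff hx hx' (l := 1)).1 (ordVal_lt_one_iff.1 h), by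
    rw [div_div, pow_succ]⟩

/-- The chart is the intersection of the normal domain `R[1/x]` and the valuation ring of `ord`. -/
theorem isIntegrallyClosedIn_blowupChart :
    IsIntegrallyClosedIn (blowupChart K (maximalIdeal R) x) K := by
  refine isIntegrallyClosedIn_iff_forall_mem.2 fun z hz => ?_
  have hx0 := algebraMap_ne_zero_of_notMem_sq (K := K) hx hx'
  have hdom : IsDomain R := (IsFractionRing.injective R K).isDomain _
  have hRic := isIntegrallyClosed_of_isRegularLocalRing R
  have hpow : Submonoid.powers x ≤ nonZeroDivisors R :=
    powers_le_nonZeroDivisors_of_noZeroDivisors fun h => hx0 (by rw [h, map_zero])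
  let L := Localization.subalgebra.ofField K (Submonoid.powers x) hpow
  have hL : blowupChart K (maximalIdeal R) x ≤ L := fun w hw => by
    obtain ⟨k, f, -, rfl⟩ := (mem_blowupChart hx hx0).1 hw
    exact ⟨f, x ^ k, ⟨k, rfl⟩, by rw [map_pow, div_eq_mul_inv]⟩
  obtain ⟨⟨_, k, rfl⟩, hk⟩ :=
    (isIntegral_of_le hL hz).exists_multiple_integral_of_isLocalization (Submonoid.powers x) z
  obtain ⟨f, hf⟩ := (isIntegrallyClosed_iff K).1 hRic hk
  have hzf : z = algebraMap R K f / algebraMap R K x ^ k := by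
    rw [hf, eq_div_iff (pow_ne_zero k hx0), Submonoid.smul_def, Algebra.smul_def, map_pow, mul_comm]
  have hord : ordVal R K z ≤ 1 :=
    valuation_le_one_of_isIntegral (fun _ => ordVal_le_one_of_mem_blowupChart hx hx') hz
  exact (mem_blowupChart hx hx0).2
    ⟨k, f, (ordVal_div_pow_le_iff hx hx' (l := 0)).1 (hzf ▸ hord), hzf⟩

end OrderOnChart

variable {Γ : Type*} [LinearOrderedCommGroupWithZero Γ] {v : Valuation K Γ}

namespace IsCenteredOnChart

variable {x : R} (h : IsCenteredOnChart v x)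

include h

theorem ordVal_eq : ordVal R K (algebraMap R K x) = exp (-1 : ℤ) :=
  ordVal_algebraMap_eq_exp_neg_one h.mem h.notMem_sq

theorem ordVal_pow_eq (n : ℕ) : ordVal R K (algebraMap R K x) ^ n = exp (-(n : ℤ)) := by
  rw [h.ordVal_eq, ← exp_nsmul, nsmul_eq_mul, mul_neg_one]

instance isIntegrallyClosedIn_quadraticTransform : IsIntegrallyClosedIn h.quadraticTransform K :=
  have := isIntegrallyClosedIn_blowupChart (K := K) h.mem h.notMem_sq
  isIntegrallyClosedIn_localizationAt

/-- An element of the chart of positive order is divisible by `x` in the chart. -/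
theorem ordVal_eq_one {c : K} (hc : c ∈ blowupChart K (maximalIdeal R) x) (h1 : v c = 1) :
    ordVal R K c = 1 := by
  refine le_antisymm (ordVal_le_one_of_mem_blowupChart h.mem h.notMem_sq hc) ?_
  by_contra hlt
  have hle := h.valuation_le_one_of_mem_chart _
    (div_mem_blowupChart h.mem h.notMem_sq hc (not_le.1 hlt))
  rw [map_div₀, h1, one_div, inv_le_one₀ h.valuation_pos] at hle
  exact h.lt_one.not_ge hle

theorem ordVal_le_one {z : K} (hz : z ∈ h.quadraticTransform) : ordVal R K z ≤ 1 := by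
  obtain ⟨b, hb, c, hc, hv, rfl⟩ := mem_localizationAt_center.1 hz
  rw [map_div₀, h.ordVal_eq_one hc hv, div_one]
  exact ordVal_le_one_of_mem_blowupChart h.mem h.notMem_sq hb

theorem div_mem {z : K} (hz : z ∈ h.quadraticTransform) (h1 : ordVal R K z < 1) :
    z / algebraMap R K x ∈ h.quadraticTransform := by
  obtain ⟨b, hb, c, hc, hv, rfl⟩ := mem_localizationAt_center.1 hz
  rw [map_div₀, h.ordVal_eq_one hc hv, div_one] at h1
  refine mem_localizationAt_center.2
    ⟨_, div_mem_blowupChart h.mem h.notMem_sq hb h1, c, hc, hv, ?_⟩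
  rw [div_div, div_div, mul_comm]

theorem div_pow_mem {z : K} (hz : z ∈ h.quadraticTransform) {n : ℕ}
    (hn : ordVal R K z ≤ ordVal R K (algebraMap R K x) ^ n) :
    z / algebraMap R K x ^ n ∈ h.quadraticTransform := by
  induction n with
  | zero => simpa using hz
  | succ n ih =>
    have hord := h.ordVal_eq
    have hx1 : ordVal R K (algebraMap R K x) ≤ 1 := (ordVal_lt_one_iff.2 hord.le).le
    have hpos : 0 < ordVal R K (algebraMap R K x) ^ n := pow_pos (hord ▸ exp_pos) n
    rw [pow_succ] at hn
    rw [pow_succ, ← div_div]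
    refine h.div_mem (ih (hn.trans (mul_le_of_le_one_right' hx1))) ?_
    rwa [ordVal_lt_one_iff, map_div₀, map_pow, div_le_iff₀ hpos, ← hord, mul_comm]

theorem valuation_eq_pow_of_mul_eq {g u : K} (hg : g ∈ h.quadraticTransform)
    (hu : u ∈ h.quadraticTransform) {n : ℕ} (hgu : g * u = algebraMap R K x ^ n)
    (h1 : ordVal R K u = 1) : v g = v (algebraMap R K x) ^ n := by
  have hord : ordVal R K g = ordVal R K (algebraMap R K x) ^ n := by
    rw [← map_pow, ← hgu, map_mul, h1, mul_one]
  have hle := h.valuationDominates.le_one _ (h.div_pow_mem hg hord.le)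
  rw [map_div₀, map_pow, div_le_one₀ (pow_pos h.valuation_pos n)] at hle
  refine le_antisymm hle ?_
  rw [← map_pow, ← hgu, map_mul]
  exact mul_le_of_le_one_right' (h.valuationDominates.le_one _ hu)

/-- The center of `ord` is a prime strictly between `0` and the maximal ideal. -/
theorem two_le_ringKrullDim_quadraticTransform {t : K} (ht : t ∈ h.quadraticTransform)
    (ht1 : v t < 1) (ht0 : ordVal R K t = 1) : 2 ≤ ringKrullDim h.quadraticTransform := by
  let q := center (ordVal R K) h.quadraticTransform fun _ => h.ordVal_le_one
  have hbot : ⊥ < q := by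
    refine bot_lt_iff_ne_bot.2 ((Submodule.ne_bot_iff q).2
      ⟨algebraMap R _ x, ?_, fun h0 => h.ne_zero (congrArg Subtype.val h0)⟩)
    exact mem_center.2 (ordVal_lt_one_iff.2 h.ordVal_eq.le)
  have hmax : q < maximalIdeal h.quadraticTransform := by
    refine (le_maximalIdeal Ideal.IsPrime.ne_top').lt_of_not_ge fun hle => ?_
    have htq : (⟨t, ht⟩ : h.quadraticTransform) ∈ q :=
      hle (h.valuationDominates.mem_maximalIdeal_iff.2 ht1)
    exact (mem_center.1 htq).ne ht0
  exact two_le_ringKrullDim_of_lt hbot hmax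

theorem dvd_pow_of_dvd_pow_add {c : h.quadraticTransform} {N r : ℕ}
    (hc : ordVal R K (algebraMap R K x) ^ r ≤ ordVal R K c)
    (hdvd : c ∣ algebraMap R h.quadraticTransform x ^ (N + r)) :
    c ∣ algebraMap R h.quadraticTransform x ^ r := by
  obtain ⟨t, ht⟩ := hdvd
  have htK : algebraMap R K x ^ (N + r) = c * t := congrArg Subtype.val ht
  have hcpos : 0 < ordVal R K c := (pow_pos (h.ordVal_eq ▸ exp_pos) r).trans_le hc
  have htN : ordVal R K t ≤ ordVal R K (algebraMap R K x) ^ N := by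
    rw [← mul_le_mul_iff_right₀ hcpos, ← map_mul, ← htK, map_pow, pow_add, mul_comm]
    exact mul_le_mul_left hc _
  refine ⟨⟨_, h.div_pow_mem t.2 htN⟩, Subtype.ext ?_⟩
  change algebraMap R K x ^ r = c * (t / algebraMap R K x ^ N)
  rw [← mul_div_assoc, ← htK, pow_add, mul_div_cancel_left₀ _ (pow_ne_zero N h.ne_zero)]

section BasePoint

variable {I : Ideal R} {r : ℕ} (hI : I ≤ maximalIdeal R ^ r)

include hI

theorem isLeast_span_pow {b : R} (hb : b ∈ I) (hb' : b ∉ maximalIdeal R ^ (r + 1))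
    (hrad : x ∈ I.radical) :
    IsLeast {L : Ideal h.quadraticTransform | Submodule.IsPrincipal L ∧
      I.map (algebraMap R h.quadraticTransform) ≤ L}
      (Ideal.span {algebraMap R h.quadraticTransform x ^ r}) := by
  refine ⟨⟨⟨_, rfl⟩, Ideal.map_le_iff_le_comap.2 fun y hy => ?_⟩, ?_⟩
  · simpa using h.algebraMap_mem_span_pow_mul hI hy (M := ⊤) trivial
  rintro L ⟨⟨c, rfl⟩, hc⟩
  have hdvd {y : R} (hy : y ∈ I) : c ∣ algebraMap R h.quadraticTransform y :=
    Ideal.mem_span_singleton.1 (hc (Ideal.mem_map_of_mem _ hy))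
  obtain ⟨N, hN⟩ := hrad
  obtain ⟨s, hs⟩ := hdvd hb
  have hbc : algebraMap R K b = c * s := congrArg Subtype.val hs
  refine (Ideal.span_singleton_le_iff_mem _).2
    (Ideal.mem_span_singleton.2 (h.dvd_pow_of_dvd_pow_add (N := N) ?_ ?_))
  · rw [h.ordVal_pow_eq, ← ordVal_algebraMap_eq (K := K) (hI hb) hb', hbc, map_mul]
    exact mul_le_of_le_one_right' (h.ordVal_le_one s.2)
  · rw [pow_add, ← map_pow]
    exact (hdvd hN).mul_right _

theorem quadraticTransform_mem_basePoints {b : R} (hb : b ∈ I)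
    (hb' : b ∉ maximalIdeal R ^ (r + 1)) (hrad : x ∈ I.radical)
    (hlt : ∀ y ∈ I, v (algebraMap R K y) < v (algebraMap R K x) ^ r) :
    h.quadraticTransform ∈ basePointsInFirstNeighborhood K I := by
  have hdiv (y : R) (hy : y ∈ I) : v (algebraMap R K y / algebraMap R K x ^ r) < 1 := by
    rw [map_div₀, map_pow, div_lt_one₀ (pow_pos h.valuation_pos r)]
    exact hlt y hy
  have hord : ordVal R K (algebraMap R K b / algebraMap R K x ^ r) = 1 := by
    rw [map_div₀, map_pow, ordVal_algebraMap_eq (hI hb) hb', h.ordVal_pow_eq,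
      div_self exp_ne_zero]
  have hle : I.map (algebraMap R h.quadraticTransform) ≤
      Ideal.span {algebraMap R h.quadraticTransform x ^ r} * maximalIdeal h.quadraticTransform :=
    Ideal.map_le_iff_le_comap.2 fun y hy => h.algebraMap_mem_span_pow_mul hI hy
      (h.valuationDominates.mem_maximalIdeal_iff.2 (hdiv y hy))
  obtain ⟨J, hJ, hJI⟩ := exists_le_span_singleton_mul_eq hle
  have hx0 : x ≠ 0 := fun h0 => h.ne_zero (by rw [h0, map_zero])
  exact ⟨⟨⟨x, h.mem, hx0, _, inferInstance, rfl⟩, h.dominates_quadraticTransform,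
    h.two_le_ringKrullDim_quadraticTransform (h.algebraMap_div_pow_mem (hI hb)) (hdiv b hb) hord⟩,
    J, ⟨_, pow_ne_zero r fun h0 => h.ne_zero (congrArg Subtype.val h0),
      h.isLeast_span_pow hI hb hb' hrad, hJI⟩,
    ne_top_of_le_ne_top (maximalIdeal.isMaximal _).ne_top hJ⟩

end BasePoint

end IsCenteredOnChart

theorem exists_le_maximalIdeal_pow {I : Ideal R} (hI : I ≠ ⊥) :
    ∃ r, I ≤ maximalIdeal R ^ r ∧ ∃ b ∈ I, b ∉ maximalIdeal R ^ (r + 1) := by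
  classical
  have hex : ∃ n, ∃ b ∈ I, b ∉ maximalIdeal R ^ (n + 1) := by
    obtain ⟨b, hb, hb0⟩ := Submodule.exists_mem_ne_zero_of_ne_bot hI
    by_contra! hall
    exact hb0 (ord_eq_top_iff.1 (ENat.eq_top_iff_forall_ge.2 fun n =>
      natCast_le_ord_iff.2 (Ideal.pow_le_pow_right n.le_succ (hall n b hb))))
  refine ⟨Nat.find hex, fun b hb => ?_, Nat.find_spec hex⟩
  rcases h : Nat.find hex with _ | k
  · simp
  · have hmin := Nat.find_min hex (m := k) (by omega)
    push Not at hmin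
    exact hmin b hb

/-- Every valuation ring dominating `S` contains a base point of `I`, and a power of the maximal
ideal is generated by one and the same element in all of these finitely many local rings. -/
theorem isPrincipal_map_of_forall_valuation_lt (hm : maximalIdeal R ≠ ⊥) {I : Ideal R}
    (hrad : I.radical = maximalIdeal R) (hfin : (basePointsInFirstNeighborhood K I).Finite)
    {S : Subalgebra R K} [IsLocalRing S] [IsIntegrallyClosedIn S K] (hdom : Dominates S) {r : ℕ}
    (hI : I ≤ maximalIdeal R ^ r) {b : R} (hb : b ∈ I) (hb' : b ∉ maximalIdeal R ^ (r + 1))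
    (hlt : ∀ W : ValuationSubring K, ValuationDominates W.valuation S → ∀ x,
      IsCenteredOnChart W.valuation x → ∀ y ∈ I,
        W.valuation (algebraMap R K y) < W.valuation (algebraMap R K x) ^ r) :
    ((maximalIdeal R).map (algebraMap R S)).IsPrincipal := by
  have := hfin.to_subtype
  have hloc (T : basePointsInFirstNeighborhood K I) : IsLocalRing T.1 :=
    isLocalRing_of_mem_blowup T.2.1.1
  obtain ⟨e, he, F, hF, hgen⟩ := exists_forall_map_pow_eq_span (m := maximalIdeal R)
    (fun T : basePointsInFirstNeighborhood K I => T.1)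
    (fun T => isPrincipal_map_of_mem_blowup T.2.1.1) fun T => map_ne_bot_of_ne_bot hm
  have hbase {u : K} (hu : u ∉ S) : ∃ W : ValuationSubring K, u ∉ W ∧
      ∃ T : basePointsInFirstNeighborhood K I, ∀ z ∈ T.1, z ∈ W := by
    obtain ⟨W, hW, huW⟩ := exists_valuationSubring_dominates hu
    obtain ⟨x, hx⟩ := exists_isCenteredOnChart hm hdom hW
    exact ⟨W, huW, ⟨hx.quadraticTransform, hx.quadraticTransform_mem_basePoints hI hb hb'
      (hrad ▸ hx.mem) (hlt W hW x hx)⟩,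
      fun z hz => (W.valuation_le_one_iff z).1 (hx.valuationDominates.le_one z hz)⟩
  have hF0 : algebraMap R K F ≠ 0 := by
    obtain ⟨y, hy, hy0⟩ := Submodule.exists_mem_ne_zero_of_ne_bot hm
    have hyS : (algebraMap R K y)⁻¹ ∉ S := fun hyS => (mem_maximalIdeal y).1 hy
      (hdom.map_nonunit y (isUnit_iff_inv_mem.2 ⟨by simpa using hy0, hyS⟩))
    obtain ⟨-, -, T, -⟩ := hbase hyS
    intro h0
    refine pow_ne_zero e (map_ne_bot_of_ne_bot (T := T.1) hm) ((hgen T).trans ?_)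
    rw [show algebraMap R T.1 F = 0 from Subtype.ext h0, Ideal.span_singleton_zero,
      Ideal.zero_eq_bot]
  refine isPrincipal_map_of_forall_div_mem he hF hF0 fun y hy => ?_
  by_contra hyS
  obtain ⟨W, hyW, T, hTW⟩ := hbase hyS
  exact hyW (hTW _ (div_mem_of_map_pow_eq_span hF0 (hgen T) hy))

end QuadraticTransforms

/-! ### Divisorial hulls -/

section DivisorialHulls

open scoped nonZeroDivisors

section DivisorialHull

variable {A F : Type*} [CommRing A] [IsDomain A] [Field F] [Algebra A F] [IsFractionRing A F]

instance noZeroDivisors_fractionalIdeal : NoZeroDivisors (FractionalIdeal A⁰ F) where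
  eq_zero_or_eq_zero_of_mul_eq_zero {I J} h := by
    by_contra! hne
    obtain ⟨hI, hJ⟩ := hne
    rw [Ne, FractionalIdeal.eq_zero_iff] at hI hJ
    push Not at hI hJ
    obtain ⟨x, hx, hx0⟩ := hI
    obtain ⟨y, hy, hy0⟩ := hJ
    exact mul_ne_zero hx0 hy0
      (FractionalIdeal.eq_zero_iff.1 h _ (FractionalIdeal.mul_mem_mul hx hy))

variable {X J : FractionalIdeal A⁰ F}

theorem le_inv_iff_mul_le_one (hJ : J ≠ 0) : X ≤ J⁻¹ ↔ X * J ≤ 1 := by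
  rw [FractionalIdeal.inv_eq, FractionalIdeal.le_div_iff_mul_le hJ]

theorem le_inv_inv (hJ : J ≠ 0) (hJ' : J⁻¹ ≠ 0) : J ≤ J⁻¹⁻¹ := by
  rw [le_inv_iff_mul_le_one hJ', mul_comm, ← le_inv_iff_mul_le_one hJ]

theorem inv_inv_ne_zero (hJ : J ≠ 0) (hJ' : J⁻¹ ≠ 0) : J⁻¹⁻¹ ≠ 0 :=
  ne_bot_of_le_ne_bot hJ (le_inv_inv hJ hJ')

theorem inv_inv_inv_eq (hJ : J ≠ 0) (hJ' : J⁻¹ ≠ 0) : J⁻¹⁻¹⁻¹ = J⁻¹ :=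
  le_antisymm (FractionalIdeal.inv_anti_mono hJ (inv_inv_ne_zero hJ hJ') (le_inv_inv hJ hJ'))
    (le_inv_inv hJ' (inv_inv_ne_zero hJ hJ'))

theorem inv_coeIdeal_ne_zero {M : Ideal A} (hM : M ≠ ⊥) : (M : FractionalIdeal A⁰ F)⁻¹ ≠ 0 := by
  refine ne_bot_of_le_ne_bot one_ne_zero
    ((le_inv_iff_mul_le_one (FractionalIdeal.coeIdeal_ne_zero.2 hM)).2 ?_)
  rw [one_mul]
  exact FractionalIdeal.coeIdeal_le_one

theorem mul_inv_inv_pow_le_one (hJ : J ≠ 0) (hJ' : J⁻¹ ≠ 0) {n : ℕ} (h : X * J ^ n ≤ 1) :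
    X * J⁻¹⁻¹ ^ n ≤ 1 := by
  induction n generalizing X with
  | zero => simpa using h
  | succ n ih =>
    rw [pow_succ, ← mul_assoc, ← le_inv_iff_mul_le_one hJ, ← inv_inv_inv_eq hJ hJ',
      le_inv_iff_mul_le_one (inv_inv_ne_zero hJ hJ'), mul_right_comm] at h
    rw [pow_succ', ← mul_assoc]
    exact ih h

theorem inv_inv_pow_inv (hJ : J ≠ 0) (hJ' : J⁻¹ ≠ 0) (n : ℕ) : (J⁻¹⁻¹ ^ n)⁻¹ = (J ^ n)⁻¹ := by
  have h0 := pow_ne_zero n (inv_inv_ne_zero hJ hJ')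
  refine le_antisymm (FractionalIdeal.inv_anti_mono (pow_ne_zero n hJ) h0
    (pow_le_pow_left' (le_inv_inv hJ hJ') n)) ?_
  rw [le_inv_iff_mul_le_one h0]
  exact mul_inv_inv_pow_le_one hJ hJ' ((le_inv_iff_mul_le_one (pow_ne_zero n hJ)).1 le_rfl)

end DivisorialHull

section HullGenerator

variable {A : Type*} [CommRing A] {M : Ideal A} {g : A}

/-- The divisorial hull of the nonzero ideal `M` of the domain `A` is the principal ideal `gA`.
Equivalently, a fraction `z` satisfies `zM ⊆ A` if and only if `zg ∈ A`; with `z = p / q` this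
is phrased in terms of divisibility in `A`. -/
def IsHullGenerator (M : Ideal A) (g : A) : Prop :=
  ∀ p q : A, (∀ y ∈ M, q ∣ p * y) ↔ q ∣ p * g

namespace IsHullGenerator

theorem dvd (h : IsHullGenerator M g) {y : A} (hy : y ∈ M) : g ∣ y := by
  simpa using (h 1 g).2 (by simp) y hy

theorem dvd_of_forall_dvd (h : IsHullGenerator M g) {q : A} (hq : ∀ y ∈ M, q ∣ y) : q ∣ g := by
  simpa using (h 1 q).1 (by simpa using hq)

theorem not_isUnit [UniqueFactorizationMonoid A] (h : IsHullGenerator M g) {a : A}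
    (ha : ¬ IsUnit a) (ha0 : a ≠ 0) (hM : M ≤ (Ideal.span {a}).radical) : ¬ IsUnit g := by
  obtain ⟨p, hp, hpa⟩ := WfDvdMonoid.exists_irreducible_factor ha ha0
  refine not_isUnit_of_not_isUnit_dvd hp.not_isUnit (h.dvd_of_forall_dvd fun y hy => ?_)
  obtain ⟨N, hN⟩ := hM hy
  exact (UniqueFactorizationMonoid.irreducible_iff_prime.1 hp).dvd_of_dvd_pow
    (hpa.trans (Ideal.mem_span_singleton.1 hN))

end IsHullGenerator

theorem exists_isHullGenerator_of_uniqueFactorizationMonoid [UniqueFactorizationMonoid A]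
    (hM : M.FG) : ∃ g, IsHullGenerator M g := by
  obtain ⟨s, rfl⟩ := hM
  let _ : NormalizedGCDMonoid A := Classical.choice inferInstance
  refine ⟨s.gcd id, fun p q => ?_⟩
  rw [← (Finset.gcd_mul_left' s id p).dvd_iff_dvd_right, Finset.dvd_gcd_iff]
  refine ⟨fun h y hy => h y (Ideal.subset_span hy), fun h y hy => ?_⟩
  induction hy using Submodule.span_induction with
  | mem y hy => exact h y hy
  | zero => simp
  | add y z _ _ hy hz => rw [mul_add]; exact dvd_add hy hz
  | smul c y _ hy => rw [smul_eq_mul, mul_left_comm]; exact hy.mul_left c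

theorem exists_isHullGenerator_of_inv_inv_eq [IsDomain A] {F : Type*} [Field F] [Algebra A F]
    [IsFractionRing A F] (hM : M ≠ ⊥) {x : F} (hx0 : x ≠ 0)
    (hx : (M : FractionalIdeal A⁰ F)⁻¹⁻¹ = FractionalIdeal.spanSingleton A⁰ x) :
    ∃ g, IsHullGenerator M g := by
  have hM0 : (M : FractionalIdeal A⁰ F) ≠ 0 := FractionalIdeal.coeIdeal_ne_zero.2 hM
  have hinv : (M : FractionalIdeal A⁰ F)⁻¹ = FractionalIdeal.spanSingleton A⁰ x⁻¹ := by
    rw [← inv_inv_inv_eq hM0 (inv_coeIdeal_ne_zero hM), hx, FractionalIdeal.spanSingleton_inv]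
  have hmem (z : F) : (∀ y ∈ M, ∃ s : A, algebraMap A F s = z * algebraMap A F y) ↔
      ∃ s : A, algebraMap A F s = z * x := by
    have hz : z ∈ (M : FractionalIdeal A⁰ F)⁻¹ ↔ ∃ s : A, algebraMap A F s = z * x := by
      simp only [hinv, FractionalIdeal.mem_spanSingleton, Algebra.smul_def, ← div_eq_mul_inv,
        div_eq_iff hx0]
    rw [← hz, FractionalIdeal.mem_inv_iff hM0]
    simp [FractionalIdeal.mem_coeIdeal, FractionalIdeal.mem_one_iff]
  obtain ⟨g, hg⟩ := (hmem 1).1 fun y _ => ⟨y, (one_mul _).symm⟩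
  rw [one_mul] at hg
  refine ⟨g, fun p q => ?_⟩
  rcases eq_or_ne q 0 with rfl | hq
  · obtain ⟨y, hy, hy0⟩ := Submodule.exists_mem_ne_zero_of_ne_bot hM
    have hg0 : g ≠ 0 := fun h0 => hx0 (by rw [← hg, h0, map_zero])
    simp only [zero_dvd_iff, mul_eq_zero, hg0, or_false]
    exact ⟨fun h => (h y hy).resolve_right hy0, fun h y _ => .inl h⟩
  have hdvd (y : A) : q ∣ p * y ↔
      ∃ s : A, algebraMap A F s = algebraMap A F p / algebraMap A F q * algebraMap A F y := by
    have hq0 : algebraMap A F q ≠ 0 := by simpa using hq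
    refine exists_congr fun s => ?_
    rw [div_mul_eq_mul_div, eq_div_iff hq0, ← map_mul, ← map_mul,
      (IsFractionRing.injective A F).eq_iff, mul_comm s, eq_comm]
  simp only [hdvd, hmem, hg]

theorem HasTorsionDivisorClassGroup.exists_isHullGenerator [IsDomain A]
    (h : HasTorsionDivisorClassGroup A) (hM : M ≠ ⊥) :
    ∃ n, 0 < n ∧ ∃ g, IsHullGenerator (M ^ n) g := by
  have hM0 : (M : FractionalIdeal A⁰ (FractionRing A)) ≠ 0 :=
    FractionalIdeal.coeIdeal_ne_zero.2 hM
  have hM' := inv_coeIdeal_ne_zero (F := FractionRing A) hM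
  obtain ⟨n, hn, x, hx0, hx⟩ :=
    h _ (inv_inv_ne_zero hM0 hM') (by rw [inv_inv_inv_eq hM0 hM'])
  rw [inv_inv_pow_inv hM0 hM', ← FractionalIdeal.coeIdeal_pow] at hx
  exact ⟨n, hn, exists_isHullGenerator_of_inv_inv_eq (pow_ne_zero n hM) hx0 hx⟩

end HullGenerator

end DivisorialHulls

/-! ### Points of the normalized blowup -/

section NormalizedBlowupPoints

open WithZero

section Localization

variable {R K : Type*} [CommRing R] [Field K] [Algebra R K] {S : Subalgebra R K}

theorem dvd_iff_div_mem {w z : S} (hw : (w : K) ≠ 0) : w ∣ z ↔ (z : K) / w ∈ S := by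
  constructor
  · rintro ⟨t, rfl⟩
    rw [MulMemClass.coe_mul, mul_div_cancel_left₀ _ hw]
    exact t.2
  · exact fun h => ⟨⟨_, h⟩, Subtype.ext (mul_div_cancel₀ _ hw).symm⟩

theorem exists_notMem_forall_dvd_mul (P : Ideal S) [P.IsPrime] {M : Ideal R} (hM : M.FG) {w : S}
    (hw : (w : K) ≠ 0) (h : ∀ y ∈ M, algebraMap R K y / w ∈ localizationAt S P) :
    ∃ c ∉ P, ∀ y ∈ M.map (algebraMap R S), w ∣ c * y := by
  obtain ⟨s, rfl⟩ := hM
  obtain ⟨⟨c, hcP⟩, hc⟩ := IsLocalization.exist_integer_multiples_of_finite P.primeCompl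
    fun y : s => (⟨_, h y (Ideal.subset_span y.2)⟩ : localizationAt S P)
  refine ⟨c, hcP, fun y hy => ?_⟩
  rw [Ideal.map_span] at hy
  induction hy using Submodule.span_induction with
  | mem _ hy =>
    obtain ⟨y, hys, rfl⟩ := hy
    obtain ⟨t, ht⟩ := hc ⟨y, hys⟩
    have htK : (t : K) = c * (algebraMap R K y / w) := congrArg Subtype.val ht
    refine (dvd_iff_div_mem hw).2 ?_
    change (c : K) * algebraMap R K y / w ∈ S
    rw [mul_div_assoc, ← htK]
    exact t.2
  | zero => simp
  | add y z _ _ hy hz => rw [mul_add]; exact dvd_add hy hz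
  | smul d y _ hy => rw [smul_eq_mul, mul_left_comm]; exact hy.mul_left d

theorem map_radical_le_radical_span {I : Ideal R} {a : R} (ha0 : algebraMap R K a ≠ 0)
    (h : ∀ b ∈ I, algebraMap R K b / algebraMap R K a ∈ S) :
    I.radical.map (algebraMap R S) ≤ (Ideal.span {algebraMap R S a}).radical :=
  (Ideal.map_radical_le _).trans (Ideal.radical_mono (Ideal.map_le_iff_le_comap.2 fun b hb =>
    Ideal.mem_span_singleton.2 ((dvd_iff_div_mem ha0).2 (h b hb))))

theorem isPrincipal_of_valuation_pow_eq [IsLocalRing S] {Γ : Type*}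
    [LinearOrderedCommGroupWithZero Γ] {v : Valuation K Γ} (hv : ValuationDominates v S)
    {M : Ideal S} {n r : ℕ} (hn : 0 < n) (hr : 0 < r) {g a : S}
    (hM : ∀ y ∈ M ^ n, g ∣ y) (ha : a ∈ M ^ r) (ha0 : a ≠ 0)
    (hva : v (a : K) ^ n = v (g : K) ^ r) : M.IsPrincipal := by
  have hMg : M ^ (n * r) ≤ Ideal.span {g ^ r} := by
    rw [pow_mul, ← Ideal.span_singleton_pow]
    exact Ideal.pow_right_mono (fun y hy => Ideal.mem_span_singleton.2 (hM y hy)) r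
  have han : a ^ n ∈ M ^ (n * r) := by
    rw [mul_comm, pow_mul]
    exact Ideal.pow_mem_pow ha n
  obtain ⟨u, hu⟩ := Ideal.mem_span_singleton.1 (hMg han)
  have huK : (a : K) ^ n = g ^ r * u := congrArg Subtype.val hu
  have hu1 : IsUnit u := by
    have hva0 : v (a : K) ^ n ≠ 0 :=
      pow_ne_zero n ((Valuation.ne_zero_iff v).2 fun h0 => ha0 (Subtype.ext h0))
    have hvu : v (a : K) ^ n * 1 = v (a : K) ^ n * v (u : K) := by
      rw [mul_one]
      nth_rw 2 [hva]
      rw [← map_pow, huK, map_mul, map_pow]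
    exact hv.isUnit_iff.2 (mul_left_cancel₀ hva0 hvu).symm
  refine isPrincipal_of_pow_eq_span_singleton (Nat.mul_pos hn hr) (pow_ne_zero n ha0)
    (le_antisymm (hMg.trans ?_) ((Ideal.span_singleton_le_iff_mem _).2 han))
  rw [hu, Ideal.span_singleton_mul_right_unit hu1]

end Localization

section PowerOfGenerator

variable {R K : Type*} [CommRing R] [IsLocalRing R] [Field K] [Algebra R K] {Γ : Type*}
  [LinearOrderedCommGroupWithZero Γ] {v : Valuation K Γ} {x : R} (h : IsCenteredOnChart v x)
  {r : ℕ} {a : R} (hva : v (algebraMap R K a) = v (algebraMap R K x) ^ r)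

include h hva

theorem IsCenteredOnChart.algebraMap_ne_zero_of_valuation_eq_pow : algebraMap R K a ≠ 0 :=
  (Valuation.ne_zero_iff v).1 (hva ▸ pow_ne_zero r h.valuation_pos.ne')

theorem isPrincipal_map_of_isHullGenerator {S : Subalgebra R K} [IsLocalRing S]
    (hv : ValuationDominates v S) (hr : 0 < r) (ha : a ∈ maximalIdeal R ^ r) {n : ℕ} (hn : 0 < n)
    {g : S} (hg : IsHullGenerator ((maximalIdeal R).map (algebraMap R S) ^ n) g)
    (hvg : v (g : K) = v (algebraMap R K x) ^ n) :
    ((maximalIdeal R).map (algebraMap R S)).IsPrincipal := by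
  refine isPrincipal_of_valuation_pow_eq hv hn hr (a := algebraMap R S a) (fun _ => hg.dvd) ?_ ?_ ?_
  · rw [← Ideal.map_pow]
    exact Ideal.mem_map_of_mem _ ha
  · exact fun h0 => h.algebraMap_ne_zero_of_valuation_eq_pow hva (congrArg Subtype.val h0)
  · change v (algebraMap R K a) ^ n = _
    rw [hva, hvg, ← pow_mul, ← pow_mul, mul_comm]

end PowerOfGenerator

variable {R K : Type*} [CommRing R] [IsRegularLocalRing R] [Field K] [Algebra R K]
  [IsFractionRing R K] {Γ : Type*} [LinearOrderedCommGroupWithZero Γ] {v : Valuation K Γ}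
  {S : Subalgebra R K} {x : R}

namespace IsCenteredOnChart

variable (h : IsCenteredOnChart v x) (hS : S ≤ h.quadraticTransform)

include hS

/-- The element `x / g` of `S` has order zero: otherwise it is divisible by `x` in the quadratic
transform, and `g` is a unit there. -/
theorem valuation_eq_of_isHullGenerator_of_lt_one {g : S}
    (hg : IsHullGenerator ((maximalIdeal R).map (algebraMap R S)) g) (hvg : v (g : K) < 1) :
    v (g : K) = v (algebraMap R K x) := by
  obtain ⟨u, hu⟩ := hg.dvd (Ideal.mem_map_of_mem _ h.mem)
  have huK : algebraMap R K x = g * u := congrArg Subtype.val hu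
  rcases (h.ordVal_le_one (hS u.2)).lt_or_eq with hlt | heq
  · have hgu : v (g * (u / algebraMap R K x)) < 1 := by
      rw [map_mul]
      exact mul_lt_one_of_lt_of_le hvg
        (h.valuationDominates.le_one _ (h.div_mem (hS u.2) hlt))
    rw [← mul_div_assoc, ← huK, div_self h.ne_zero, map_one] at hgu
    exact absurd hgu (lt_irrefl 1)
  · simpa using h.valuation_eq_pow_of_mul_eq (n := 1) (hS g.2) (hS u.2)
      (by rw [pow_one, huK]) heq

/-- The quotient `u = xⁿ / g` divides an element of order zero: the ideal `𝔪ⁿ` is generated by `xⁿ`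
in the order valuation ring, which is a localization of `S`. -/
theorem valuation_eq_pow_of_isHullGenerator (hSV : ∀ z ∈ S, ordVal R K z ≤ 1)
    (hV : ∀ z, ordVal R K z ≤ 1 → z ∈ localizationAt S (center (ordVal R K) S hSV)) {n : ℕ} {g : S}
    (hg : IsHullGenerator ((maximalIdeal R).map (algebraMap R S) ^ n) g) :
    v (g : K) = v (algebraMap R K x) ^ n := by
  obtain ⟨u, hu⟩ := hg.dvd (Ideal.pow_mem_pow (Ideal.mem_map_of_mem _ h.mem) n)
  have huK : algebraMap R K x ^ n = g * u := congrArg Subtype.val hu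
  have hxn := pow_ne_zero n h.ne_zero
  obtain ⟨c, hcP, hc⟩ := exists_notMem_forall_dvd_mul (center (ordVal R K) S hSV)
    (M := maximalIdeal R ^ n) (w := algebraMap R S x ^ n) (IsNoetherian.noetherian _) hxn
    fun y hy => hV _ ((ordVal_div_pow_le_iff h.mem h.notMem_sq (l := 0)).2 hy)
  rw [Ideal.map_pow] at hc
  have hgc := (hg _ _).1 hc
  have hg0 : g ≠ 0 := by
    rintro rfl
    exact hxn (by rw [huK, ZeroMemClass.coe_zero, zero_mul])
  rw [hu, mul_comm c, mul_dvd_mul_iff_left hg0] at hgc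
  obtain ⟨d, rfl⟩ := hgc
  refine h.valuation_eq_pow_of_mul_eq (hS g.2) (hS u.2) huK.symm (le_antisymm (hSV _ u.2) ?_)
  rw [← notMem_center.1 hcP, MulMemClass.coe_mul, map_mul]
  exact mul_le_of_le_one_right' (hSV _ d.2)

end IsCenteredOnChart

/-- Both points are centers of the order valuation on a normalized blowup of `I`. -/
theorem mem_localizationAt_center_of_ordVal_le_one {I : Ideal R} {a : R} (ha : a ∈ I)
    (ha0 : algebraMap R K a ≠ 0) (hS : ∀ b ∈ I, algebraMap R K b / algebraMap R K a ∈ S)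
    [IsIntegrallyClosedIn S K] (hSV : ∀ z ∈ S, ordVal R K z ≤ 1) {V : Subalgebra R K}
    (hV : V ∈ normalizedBlowup K I) (hVord : (V : Set K) = ordValuationRing R K) (z : K)
    (hz : ordVal R K z ≤ 1) : z ∈ localizationAt S (center (ordVal R K) S hSV) := by
  have hVmem {z : K} : z ∈ V ↔ ordVal R K z ≤ 1 := by
    rw [← SetLike.mem_coe, hVord, mem_ordValuationRing_iff]
  obtain ⟨a', ha', ha0', P, hP, rfl⟩ := hV
  have hav : ordVal R K (algebraMap R K a) ≠ 0 := (Valuation.ne_zero_iff _).2 ha0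
  have hav' : ordVal R K (algebraMap R K a') ≠ 0 :=
    (Valuation.ne_zero_iff _).2 (by simpa using ha0')
  have haa' : ordVal R K (algebraMap R K a') = ordVal R K (algebraMap R K a) := by
    refine le_antisymm ?_ ?_
    · have hle := hSV _ (hS a' ha')
      rwa [map_div₀, div_le_one₀ (zero_lt_iff.2 hav)] at hle
    · have hle := hVmem.1 (div_mem_localizationAt P ha)
      rwa [map_div₀, div_le_one₀ (zero_lt_iff.2 hav')] at hle
  exact localizationAt_normalizedBlowupChart_le valuationDominates_localizationAt_center
    (fun b hb => le_localizationAt _ _ (hS b hb)) hav ha' haa' (fun _ => hVmem.1) (hVmem.2 hz)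

section DivisorialHull

variable [IsLocalRing S] {r : ℕ} {a : R} (h : IsCenteredOnChart v x)
  (hv : ValuationDominates v S) (hr : 0 < r) (ha : a ∈ maximalIdeal R ^ r)
  (hva : v (algebraMap R K a) = v (algebraMap R K x) ^ r)

include h hv hr ha hva

theorem isPrincipal_map_of_uniqueFactorizationMonoid [UniqueFactorizationMonoid S]
    (hS : S ≤ h.quadraticTransform)
    (hrad : (maximalIdeal R).map (algebraMap R S) ≤ (Ideal.span {algebraMap R S a}).radical) :
    ((maximalIdeal R).map (algebraMap R S)).IsPrincipal := by
  obtain ⟨g, hg⟩ := exists_isHullGenerator_of_uniqueFactorizationMonoid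
    (Ideal.FG.map (IsNoetherian.noetherian (maximalIdeal R)) (algebraMap R S))
  have ha1 : v (algebraMap R S a : K) < 1 := hva.trans_lt (pow_lt_one₀ zero_le h.lt_one hr.ne')
  have ha0 : algebraMap R S a ≠ 0 := fun h0 =>
    h.algebraMap_ne_zero_of_valuation_eq_pow hva (congrArg Subtype.val h0)
  have hgu : ¬ IsUnit g := hg.not_isUnit (fun hu => ha1.ne (hv.isUnit_iff.1 hu)) ha0 hrad
  have hg1 : v (g : K) < 1 := (hv.le_one _ g.2).lt_of_ne fun h1 => hgu (hv.isUnit_iff.2 h1)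
  refine isPrincipal_map_of_isHullGenerator h hva hv hr ha one_pos (g := g) (by rwa [pow_one]) ?_
  rw [pow_one, h.valuation_eq_of_isHullGenerator_of_lt_one hS hg hg1]

theorem isPrincipal_map_of_hasTorsionDivisorClassGroup (htors : HasTorsionDivisorClassGroup S)
    (hS : S ≤ h.quadraticTransform) (hSV : ∀ z ∈ S, ordVal R K z ≤ 1)
    (hV : ∀ z, ordVal R K z ≤ 1 → z ∈ localizationAt S (center (ordVal R K) S hSV)) :
    ((maximalIdeal R).map (algebraMap R S)).IsPrincipal := by
  have hM : (maximalIdeal R).map (algebraMap R S) ≠ ⊥ := (Submodule.ne_bot_iff _).2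
    ⟨_, Ideal.mem_map_of_mem _ h.mem, fun h0 => h.ne_zero (congrArg Subtype.val h0)⟩
  obtain ⟨n, hn, g, hg⟩ := htors.exists_isHullGenerator hM
  exact isPrincipal_map_of_isHullGenerator h hva hv hr ha hn hg
    (h.valuation_eq_pow_of_isHullGenerator hS hSV hV hg)

end DivisorialHull

theorem maximalIdeal_ne_bot_of_two_le_ringKrullDim {R : Type*} [CommRing R] [IsLocalRing R]
    (hdim : 2 ≤ ringKrullDim R) : maximalIdeal R ≠ ⊥ := by
  intro h0
  rw [← maximalIdeal_height_eq_ringKrullDim, h0, Ideal.height_bot] at hdim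
  exact absurd hdim (by decide)

section NormalizedBlowupPoint

variable {I : Ideal R} {r : ℕ} (hI : I ≤ maximalIdeal R ^ r) {a : R} (ha : a ∈ I)

include hI ha

theorem IsCenteredOnChart.localizationAt_le_quadraticTransform (h : IsCenteredOnChart v x)
    (hva : v (algebraMap R K a) = v (algebraMap R K x) ^ r)
    {P : Ideal (normalizedBlowupChart K I a)} [P.IsPrime]
    (hv : ValuationDominates v (localizationAt (normalizedBlowupChart K I a) P)) :
    localizationAt (normalizedBlowupChart K I a) P ≤ h.quadraticTransform := by
  rw [← map_pow] at hva
  refine localizationAt_normalizedBlowupChart_le h.valuationDominates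
    (fun b hb => h.algebraMap_div_pow_mem (hI hb)) ?_ ha hva hv.le_one
  rw [map_pow]
  exact pow_ne_zero r h.valuation_pos.ne'

theorem isPrincipal_map_or_exists_valuation_eq (hm : maximalIdeal R ≠ ⊥)
    (hrad : I.radical = maximalIdeal R) (hfin : (basePointsInFirstNeighborhood K I).Finite)
    [IsLocalRing S] [IsIntegrallyClosedIn S K] (hdom : Dominates S)
    (ha0 : algebraMap R K a ≠ 0) (hS : ∀ b ∈ I, algebraMap R K b / algebraMap R K a ∈ S)
    {b : R} (hb : b ∈ I) (hb' : b ∉ maximalIdeal R ^ (r + 1)) :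
    ((maximalIdeal R).map (algebraMap R S)).IsPrincipal ∨
      ∃ W : ValuationSubring K, ValuationDominates W.valuation S ∧ ∃ x,
        IsCenteredOnChart W.valuation x ∧
          W.valuation (algebraMap R K a) = W.valuation (algebraMap R K x) ^ r := by
  rw [or_iff_not_imp_right]
  intro H
  push Not at H
  refine isPrincipal_map_of_forall_valuation_lt hm hrad hfin hdom hI hb hb'
    fun W hW x hx y hy => lt_of_le_of_lt ?_ ((hx.le_pow (hI ha)).lt_of_ne (H W hW x hx))
  have hya := hW.le_one _ (hS y hy)
  rwa [map_div₀, div_le_one₀ (zero_lt_iff.2 ((Valuation.ne_zero_iff _).2 ha0))] at hya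

end NormalizedBlowupPoint

end NormalizedBlowupPoints

end BirationalModel

end

open BirationalModel IsLocalRing in
theorem lemma2p40 {R K : Type*} [CommRing R] [IsDomain R] [IsRegularLocalRing R]
    [Field K] [Algebra R K] [IsFractionRing R K]
    (hdim : 2 ≤ ringKrullDim R)
    (I : Ideal R) (hprim : I.IsPrimary) (hrad : I.radical = IsLocalRing.maximalIdeal R)
    (hfin : (BirationalModel.basePointsInFirstNeighborhood K I).Finite)
    (S : Subalgebra R K) (hS : S ∈ BirationalModel.normalizedBlowup K I)
    (hdom : BirationalModel.Dominates S)
    (h : UniqueFactorizationMonoid S ∨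
      (BirationalModel.HasTorsionDivisorClassGroup S ∧
        ((∃ V ∈ BirationalModel.reesValuationRings K I,
            (V : Set K) = BirationalModel.ordValuationRing R K) ∨
          ¬ (S : Set K) ⊆ BirationalModel.ordValuationRing R K))) :
    Submodule.IsPrincipal ((IsLocalRing.maximalIdeal R).map (algebraMap R S)) := by
  obtain ⟨a, ha, ha0, P, hP, rfl⟩ := hS
  have haK : algebraMap R K a ≠ 0 := by simpa using ha0
  have hdiv (b : R) (hb : b ∈ I) := div_mem_localizationAt (K := K) P hb
  obtain ⟨r, hI, b, hb, hb'⟩ :=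
    exists_le_maximalIdeal_pow (I := I) ((Submodule.ne_bot_iff I).2 ⟨a, ha, ha0⟩)
  have hr : 0 < r :=
    Nat.pos_of_ne_zero fun h0 => hb' (by simpa [h0, ← hrad] using I.le_radical hb)
  obtain hprinc | ⟨W, hW, x, hx, hva⟩ := isPrincipal_map_or_exists_valuation_eq hI ha
    (maximalIdeal_ne_bot_of_two_le_ringKrullDim hdim) hrad hfin hdom haK hdiv hb hb'
  · exact hprinc
  have hST := hx.localizationAt_le_quadraticTransform hI ha hva hW
  rcases h with hufd | ⟨htors, hV⟩
  · exact isPrincipal_map_of_uniqueFactorizationMonoid hx hW hr (hI ha) hva hST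
      (hrad ▸ map_radical_le_radical_span haK hdiv)
  · have hSV := fun z hz => hx.ordVal_le_one (z := z) (hST hz)
    obtain ⟨V, ⟨hV, -⟩, hVord⟩ :=
      hV.resolve_right (not_not.2 fun z hz => mem_ordValuationRing_iff.2 (hSV z hz))
    exact isPrincipal_map_of_hasTorsionDivisorClassGroup hx hW hr (hI ha) hva htors hST hSV
      (mem_localizationAt_center_of_ordVal_le_one ha haK hdiv hSV hV hVord)
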